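/- For $z\in\mathbb{C}$ put $\|z\|=\max\{|\mathrm{Re}\,z|,|\mathrm{Im}\,z|\}$, let $[z]=\lfloor \mathrm{Re}\,z+\tfrac12\rfloor+i\lfloor \mathrm{Im}\,z+\tfrac12\rfloor$ be the nearest Gaussian integer, and let $\mathfrak{F}=\{z\in\mathbb{C}:[z]=0\}$. Let $T:\mathfrak{F}\to\mathfrak{F}$ be the complex Gauss map, $T(0)=0$ and $T(z)=z^{-1}-[z^{-1}]$ for $z\neq 0$. The Hurwitz partial quotients of $z\in\mathfrak{F}$ are $a_k(z)=[(T^{k-1}(z))^{-1}]$, defined for $k\ge 1$ as long as $T^{k-1}(z)\neq 0$. Let $\mathscr{D}=\{a\in\mathbb{Z}[i]:|a|\ge\sqrt2\}$. For $n\ge 1$ and $\mathbf{a}=(a_1,\dots,a_n)\in\mathscr{D}^n$ the cylinder $\mathcal{C}_n(\mathbf{a})$ is the set of all $z\in\mathfrak{F}$ with $a_1(z)=a_1,\dots,a_n(z)=a_n$ (all these partial quotients being defined). The word $\mathbf{a}$ is called regular if $\mathcal{C}_n(\mathbf{a})$ has non-empty interior in $\mathbb{C}$, and $\mathsf{R}(n)$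 is the set of regular words of length $n$. For $\mathbf{a}\in\mathsf{R}(n)$ and real $0<l<u$ put \[ S_n(\mathbf{a};l,u)=\bigcup_{\substack{l\le\|d\|\le u\\ \mathbf{a}d\in\mathsf{R}(n+1)}}\overline{\mathcal{C}_{n+1}(\mathbf{a}d)}, \] where $d$ runs over Gaussian integers and $\mathbf{a}d$ is the word $\mathbf{a}$ followed by $d$. Write $|A|$ for the diameter of a set $A\subseteq\mathbb{C}$ and $\mathbb{D}(z;r)$ for the open disc of radius $r$ centred at $z$. Theorem. There is a constant $\rho>0$ such that for all real numbers $l,u$ with $11<l<u$ and $\frac{22}{50}<\frac{l}{u}<\frac{28}{50}$, every $n\ge 1$, every $\mathbf{a}\in\mathsf{R}(n)$ and every $z\in S_n(\mathbf{a};l,u)$, the disc $\mathbb{D}(z;\rho|S_n(\mathbf{a};l,u)|)$ intersects at most two of the sets $S_n(\mathbf{c};l,u)$, $\mathbf{c}\in\mathsf{R}(n)$; that is, there are at most two words $\mathbf{c}\in\mathsf{R}(n)$ for which $\mathbb{D}(z;\rho|S_n(\mathbf{a};l,u)|)\cap S_n(\mathbf{c};l,u)\neq\emptyset$. -/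

import Mathlib

namespace HurwitzCF

/-- The max norm `‖z‖ = max {|Re z|, |Im z|}` on the complex plane. -/
noncomputable def maxNorm (z : ℂ) : ℝ := max |z.re| |z.im|

/-- The nearest Gaussian integer `[z] = ⌊Re z + 1/2⌋ + i ⌊Im z + 1/2⌋`. -/
noncomputable def nearest (z : ℂ) : GaussianInt := ⟨⌊z.re + 1 / 2⌋, ⌊z.im + 1 / 2⌋⟩

/-- The fundamental domain `𝔉 = {z : [z] = 0}`, a half-open unit square centred at `0`. -/
def fundDomain : Set ℂ := {z | nearest z = 0}

/-- The complex Gauss map: `T z = z⁻¹ - [z⁻¹]` for `z ≠ 0`, and `T 0 = 0`. -/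
noncomputable def gaussMap (z : ℂ) : ℂ :=
  open Classical in if z = 0 then 0 else z⁻¹ - GaussianInt.toComplex (nearest z⁻¹)

/-- `HasQuotient z k a`: the partial quotient of `z` with (zero-based) index `k` is defined
and equals `a`; that is, `T^k z ≠ 0` and `[(T^k z)⁻¹] = a`. -/
def HasQuotient (z : ℂ) (k : ℕ) (a : GaussianInt) : Prop :=
  gaussMap^[k] z ≠ 0 ∧ nearest (gaussMap^[k] z)⁻¹ = a

/-- The alphabet: the Gaussian integers `a` with `|a| ≥ √2`. -/
def alphabet : Set GaussianInt := {a | Real.sqrt 2 ≤ ‖GaussianInt.toComplex a‖}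

/-- The cylinder of level `n` based on the word `a`. -/
def cylinder {n : ℕ} (a : Fin n → GaussianInt) : Set ℂ :=
  {z | z ∈ fundDomain ∧ ∀ k : Fin n, HasQuotient z k (a k)}

/-- A word over the alphabet is regular if its cylinder has non-empty interior in `ℂ`. -/
def IsRegular {n : ℕ} (a : Fin n → GaussianInt) : Prop :=
  (∀ k, a k ∈ alphabet) ∧ (interior (cylinder a)).Nonempty

/-- `S_n(a; l, u)`: the union of the closures of the regular cylinders of level `n + 1` based on
the words `a d` with `l ≤ ‖d‖ ≤ u`. -/
def regularUnion {n : ℕ} (a : Fin n → GaussianInt) (l u : ℝ) : Set ℂ :=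
  ⋃ d ∈ {d : GaussianInt | l ≤ maxNorm (GaussianInt.toComplex d) ∧
      maxNorm (GaussianInt.toComplex d) ≤ u ∧
      IsRegular (Fin.snoc a d : Fin (n + 1) → GaussianInt)},
    closure (cylinder (Fin.snoc a d : Fin (n + 1) → GaussianInt))

end HurwitzCF

/-! If the expansion of z begins with the word c, then z = `val` c + 1/(q²X) with q = `den` c, where
X is, up to sign, the inverse of the n-th iterate of z plus an `offset` of modulus at most √2
(`Chain.coordinate`, `Good.norm_offset_le_sqrt`). The next digit has max norm between l and u, so
S_n(c) lies around the rational point `val` c at a distance comparable with 1/(l|q|²).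

A point that close to `val` a can only belong to words with the same value and the same |q|: a
rational point of small denominator that is very near a point of the unit square lies in the square
itself, so the expansions can differ only by reflections at ties of the rounding
(`Good.val_eq_of_close`).

Two different words with one value first differ at such a tie, on opposite sides of the square.
Under the remaining digits this side turns into sides of the square and unit circles
(`Tangent.step`). It ends as a unit circle through 0 around a unit β close to minus the last digit
(`Tangent.exists_unit`). In the coordinate X the two pieces then lie in opposite half-planes bounded
by a line parallel to an axis, up to a bounded error (`exists_separation`).

For three words meeting the disc, the three points X are far from 0 and relatively close together,
so all three separating lines are parallel (`axis_of_large`). One word is then caught between the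
other two, and two opposite units are near minus its last digit. This contradicts that digit having
modulus at least √2 (`not_near_opposite`). -/

namespace HurwitzCF

open GaussianInt ComplexConjugate

/-! ### Chains, good words and their denominators. -/

/-- The closed unit square centred at `0`. -/
def closedSquare : Set ℂ := {z | |z.re| ≤ 1 / 2 ∧ |z.im| ≤ 1 / 2}

/-- The open unit square centred at `0`. -/
def openSquare : Set ℂ := {z | |z.re| < 1 / 2 ∧ |z.im| < 1 / 2}

/-- `Chain D z L e`: starting from `z`, the maps `x ↦ x⁻¹ - a`, with `a` running through the
word `L`, stay inside `D` and lead to `e`. -/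
def Chain (D : Set ℂ) : ℂ → List GaussianInt → ℂ → Prop
  | z, [], e => z ∈ D ∧ e = z
  | z, a :: L, e => z ∈ D ∧ z ≠ 0 ∧ Chain D (z⁻¹ - toComplex a) L e

/-- The value `1 / (a₁ + 1 / (a₂ + ⋯))` of a finite continued fraction. -/
noncomputable def val : List GaussianInt → ℂ
  | [] => 0
  | a :: L => (toComplex a + val L)⁻¹

/-- The denominator of the value of a finite continued fraction. -/
noncomputable def den : List GaussianInt → ℂ
  | [] => 1
  | a :: L => (toComplex a + val L) * den L

/-- The translation relating the coordinate at the end of a chain to the inverse distance of its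
starting point from the value of the word. -/
noncomputable def offset : List GaussianInt → ℂ
  | [] => 0
  | a :: L => -offset L - 1 / (den L * den (a :: L))

/-- A word over the alphabet all of whose suffixes have their value in the closed square. -/
def Good : List GaussianInt → Prop
  | [] => True
  | a :: L => Real.sqrt 2 ≤ ‖toComplex a‖ ∧ val (a :: L) ∈ closedSquare ∧ Good L

lemma Chain.start_mem {D : Set ℂ} {z e : ℂ} {L : List GaussianInt} (h : Chain D z L e) :
    z ∈ D := by
  cases L <;> exact h.1

lemma openSquare_subset : openSquare ⊆ closedSquare := fun _ h => ⟨h.1.le, h.2.le⟩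

lemma Chain.mono {D D' : Set ℂ} (hD : D ⊆ D') {L : List GaussianInt} :
    ∀ {z e : ℂ}, Chain D z L e → Chain D' z L e := by
  induction L with
  | nil => exact fun h => ⟨hD h.1, h.2⟩
  | cons a L ih => exact fun h => ⟨hD h.1, h.2.1, ih h.2.2⟩

lemma sq_norm_eq (z : ℂ) : ‖z‖ ^ 2 = z.re ^ 2 + z.im ^ 2 := by
  rw [Complex.sq_norm, Complex.normSq_apply]; ring

lemma sq_norm_le_of_mem_closedSquare {w : ℂ} (h : w ∈ closedSquare) : ‖w‖ ^ 2 ≤ 1 / 2 := by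
  rw [sq_norm_eq]
  have h1 := sq_le_sq' (abs_le.1 h.1).1 (abs_le.1 h.1).2
  have h2 := sq_le_sq' (abs_le.1 h.2).1 (abs_le.1 h.2).2
  linarith

lemma Good.val_mem {L : List GaussianInt} (h : Good L) : val L ∈ closedSquare := by
  cases L with
  | nil => simp [val, closedSquare]
  | cons a L => exact h.2.1

lemma add_val_ne_zero {a : GaussianInt} {w : ℂ} (ha : Real.sqrt 2 ≤ ‖toComplex a‖)
    (hw : w ∈ closedSquare) : toComplex a + w ≠ 0 := by
  intro h
  have h1 : toComplex a = -w := eq_neg_of_add_eq_zero_left h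
  rw [h1, norm_neg] at ha
  have h2 := sq_norm_le_of_mem_closedSquare hw
  have h3 : Real.sqrt 2 ^ 2 = 2 := Real.sq_sqrt (by norm_num)
  nlinarith [Real.sqrt_nonneg 2, norm_nonneg w]

lemma Good.head_add_ne_zero {a : GaussianInt} {L : List GaussianInt} (h : Good (a :: L)) :
    toComplex a + val L ≠ 0 := add_val_ne_zero h.1 h.2.2.val_mem

/-- The denominator and the numerator are Gaussian integers, as soon as the tail is good. -/
lemma Good.den_eq {L : List GaussianInt} (h : Good L) :
    ∃ p q : GaussianInt, den L = toComplex q ∧ val L * den L = toComplex p := by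
  induction L with
  | nil => exact ⟨0, 1, by simp [den], by simp [val]⟩
  | cons a L ih =>
    obtain ⟨p, q, hq, hp⟩ := ih h.2.2
    refine ⟨q, a * q + p, ?_, ?_⟩
    · rw [den, add_mul, hp, hq]; simp
    · rw [val, den, inv_mul_cancel_left₀ h.head_add_ne_zero, hq]

lemma Good.den_ne_zero {L : List GaussianInt} (h : Good L) : den L ≠ 0 := by
  induction L with
  | nil => simp [den]
  | cons a L ih => exact mul_ne_zero h.head_add_ne_zero (ih h.2.2)

/-- As w = p/q = p·conj(q)/|q|², the norm |q|² is a common denominator of both coordinates of w. -/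
lemma integral_of_eq {p q : GaussianInt} {w d : ℂ} (hq : d = toComplex q)
    (hp : w * d = toComplex p) :
    ∃ N m k : ℤ, ‖d‖ ^ 2 = N ∧ N * w.re = m ∧ N * w.im = k := by
  refine ⟨q.re ^ 2 + q.im ^ 2, p.re * q.re + p.im * q.im, p.im * q.re - p.re * q.im, ?_, ?_, ?_⟩
  · rw [sq_norm_eq, hq]; simp
  · have h1 := congrArg Complex.re hp
    have h2 := congrArg Complex.im hp
    rw [hq] at h1 h2
    simp at h1 h2
    push_cast
    simp only [intCast_re, intCast_im]
    rw [← h1, ← h2]; ring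
  · have h1 := congrArg Complex.re hp
    have h2 := congrArg Complex.im hp
    rw [hq] at h1 h2
    simp at h1 h2
    push_cast
    simp only [intCast_re, intCast_im]
    rw [← h1, ← h2]; ring

lemma Good.integral {L : List GaussianInt} (h : Good L) :
    ∃ N m k : ℤ, ‖den L‖ ^ 2 = N ∧ N * (val L).re = m ∧ N * (val L).im = k := by
  obtain ⟨p, q, hq, hp⟩ := h.den_eq
  exact integral_of_eq hq hp

lemma one_le_sq_norm_of_int {d : ℂ} (hd : d ≠ 0) {N : ℤ} (hN : ‖d‖ ^ 2 = N) : 1 ≤ ‖d‖ := by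
  have h1 : (0 : ℝ) < N := by rw [← hN]; positivity
  have h2 : (1 : ℝ) ≤ N := by exact_mod_cast (Int.cast_pos.1 h1)
  nlinarith [norm_nonneg d]

lemma Good.one_le_norm_den {L : List GaussianInt} (h : Good L) : 1 ≤ ‖den L‖ := by
  obtain ⟨N, _, _, hN, _⟩ := h.integral
  exact one_le_sq_norm_of_int h.den_ne_zero hN

/-- A rational number close to a number in `[-1/2, 1/2]`, relative to its denominator, is in
`[-1/2, 1/2]`. -/
lemma abs_le_half_of_close {x w : ℝ} {N m : ℤ} (hN : (N : ℝ) * w = m) (h0 : (0 : ℝ) < N)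
    (hx : |x| ≤ 1 / 2) (hc : |x - w| * N < 1 / 2) : |w| ≤ 1 / 2 := by
  rw [abs_le] at hx ⊢
  have hc1 : (x - w) * N < 1 / 2 := (mul_le_mul_of_nonneg_right (le_abs_self _) h0.le).trans_lt hc
  have hc2 : -(x - w) * N < 1 / 2 :=
    (mul_le_mul_of_nonneg_right (neg_le_abs _) h0.le).trans_lt hc
  have h1 : (2 * m : ℝ) < N + 1 := by nlinarith
  have h2 : (-(N + 1) : ℝ) < 2 * m := by nlinarith
  -- Integrality removes the slack: an integer below N + 1 is at most N.
  have h1' : 2 * m ≤ N := by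
    have : 2 * m < N + 1 := by exact_mod_cast h1
    omega
  have h2' : -N ≤ 2 * m := by
    have : -(N + 1) < 2 * m := by exact_mod_cast h2
    omega
  have h1'' : (2 * m : ℝ) ≤ N := by exact_mod_cast h1'
  have h2'' : (-N : ℝ) ≤ 2 * m := by exact_mod_cast h2'
  constructor <;> nlinarith

lemma mem_closedSquare_of_close {z w d : ℂ} (hz : z ∈ closedSquare) (hd : d ≠ 0)
    (hi : ∃ N m k : ℤ, ‖d‖ ^ 2 = N ∧ N * w.re = m ∧ N * w.im = k)
    (hc : ‖z - w‖ * ‖d‖ ^ 2 < 1 / 2) : w ∈ closedSquare := by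
  obtain ⟨N, m, k, hN, hm, hk⟩ := hi
  have h0 : (0 : ℝ) < N := by rw [← hN]; positivity
  rw [hN] at hc
  refine ⟨abs_le_half_of_close hm h0 hz.1 (lt_of_le_of_lt ?_ hc),
    abs_le_half_of_close hk h0 hz.2 (lt_of_le_of_lt ?_ hc)⟩
  · exact mul_le_mul_of_nonneg_right (by simpa using Complex.abs_re_le_norm (z - w)) h0.le
  · exact mul_le_mul_of_nonneg_right (by simpa using Complex.abs_im_le_norm (z - w)) h0.le

/-- The coordinate X = 1/((z - w)q²) is chosen so that prepending a digit acts on it by a sign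
change and a translation. -/
lemma chain_step {a z w q X : ℂ} (hz : z ≠ 0) (hw : a + w ≠ 0) (hq : q ≠ 0)
    (h : (z⁻¹ - a - w) * q ^ 2 * X = 1) :
    (z - (a + w)⁻¹) * ((a + w) * q) ^ 2 * (-X - 1 / (q * ((a + w) * q))) = 1 := by
  have h2 : z * q * q * X * (a + w) = q ^ 2 * X - z := by
    field_simp at h
    linear_combination -h
  field_simp
  linear_combination -(a + w) * h2

/-- The gap between the bounds for a word and for its tail. -/
lemma gap_bound {x y : ℝ} (hy : 0 < y) (hxy : Real.sqrt 2 * y ≤ x) :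
    1 / (y * x) ≤ Real.sqrt 2 / y ^ 2 - Real.sqrt 2 / x ^ 2 := by
  have h2 : Real.sqrt 2 ^ 2 = 2 := Real.sq_sqrt (by norm_num)
  have hs : 0 < Real.sqrt 2 := by positivity
  have hx : 0 < x := lt_of_lt_of_le (by positivity) hxy
  rw [div_sub_div _ _ (by positivity) (by positivity), div_le_div_iff₀ (by positivity)
    (by positivity)]
  have h3 : y * x ≤ Real.sqrt 2 * (x ^ 2 - y ^ 2) := by
    have h4 := mul_nonneg (sub_nonneg.2 hxy) (by positivity : 0 ≤ Real.sqrt 2 * x + y)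
    have h5 : (x - Real.sqrt 2 * y) * (Real.sqrt 2 * x + y) =
        Real.sqrt 2 * (x ^ 2 - y ^ 2) + x * y - Real.sqrt 2 ^ 2 * (x * y) := by ring
    rw [h5, h2] at h4
    linarith
  have h4 := mul_le_mul_of_nonneg_left h3 (by positivity : 0 ≤ y * x)
  linarith

lemma Good.norm_den_tail {a : GaussianInt} {L : List GaussianInt} (h : Good (a :: L)) :
    Real.sqrt 2 * ‖den L‖ ≤ ‖den (a :: L)‖ := by
  have h1 := sq_norm_le_of_mem_closedSquare h.val_mem
  have h0 := h.head_add_ne_zero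
  have h0' : 0 < ‖toComplex a + val L‖ := norm_pos_iff.2 h0
  rw [den, norm_mul]
  refine mul_le_mul_of_nonneg_right ?_ (norm_nonneg _)
  apply Real.sqrt_le_iff.2 ⟨h0'.le, ?_⟩
  rw [val, norm_inv, inv_pow] at h1
  rw [inv_le_comm₀ (by positivity) (by norm_num)] at h1
  simpa using h1

/-- By `gap_bound` each increment of the offset is at most a difference of consecutive terms
√2/|q|², and these differences telescope. -/
lemma Good.norm_offset_le {L : List GaussianInt} (h : Good L) :
    ‖offset L‖ ≤ Real.sqrt 2 * (1 - 1 / ‖den L‖ ^ 2) := by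
  induction L with
  | nil => simp [offset, den]
  | cons a L ih =>
    have h1 := ih h.2.2
    have h2 := gap_bound (norm_pos_iff.2 h.2.2.den_ne_zero) h.norm_den_tail
    have h3 : ‖offset (a :: L)‖ ≤ ‖offset L‖ + 1 / (‖den L‖ * ‖den (a :: L)‖) := by
      rw [offset]
      refine (norm_sub_le _ _).trans ?_
      simp
    have e1 : Real.sqrt 2 / ‖den L‖ ^ 2 = Real.sqrt 2 * (1 / ‖den L‖ ^ 2) := by ring
    have e2 : Real.sqrt 2 / ‖den (a :: L)‖ ^ 2 = Real.sqrt 2 * (1 / ‖den (a :: L)‖ ^ 2) := by ring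
    rw [e1, e2] at h2
    linarith

lemma Good.norm_offset_le_sqrt {L : List GaussianInt} (h : Good L) :
    ‖offset L‖ ≤ Real.sqrt 2 := by
  have h1 := h.norm_offset_le
  have h2 : 0 ≤ 1 / ‖den L‖ ^ 2 := by positivity
  nlinarith [Real.sqrt_nonneg 2]

lemma Chain.coordinate {D : Set ℂ} {L : List GaussianInt} (h : Good L) :
    ∀ {z e : ℂ}, Chain D z L e → e ≠ 0 →
      (z - val L) * den L ^ 2 * ((-1) ^ L.length * e⁻¹ + offset L) = 1 := by
  induction L with
  | nil =>
    intro z e hc he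
    rw [hc.2] at he
    simp [val, den, offset, hc.2, he]
  | cons a L ih =>
    intro z e hc he
    have h1 := chain_step hc.2.1 h.head_add_ne_zero h.2.2.den_ne_zero (ih h.2.2 hc.2.2 he)
    simp only [val, den, offset, List.length_cons, pow_succ (-1 : ℂ)]
    linear_combination h1

/-- A large e⁻¹ puts z so near the value of the word, relative to its denominator, that this value
cannot lie outside the square. -/
lemma Chain.good {L : List GaussianInt} (hL : ∀ a ∈ L, Real.sqrt 2 ≤ ‖toComplex a‖) :
    ∀ {z e : ℂ}, Chain closedSquare z L e → e ≠ 0 → 8 ≤ ‖e⁻¹‖ → Good L := by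
  induction L with
  | nil => intros; trivial
  | cons a L ih =>
    intro z e hc he h8
    have hg := ih (fun b hb => hL b (List.mem_cons_of_mem _ hb)) hc.2.2 he h8
    have ha := hL a List.mem_cons_self
    have h0 := add_val_ne_zero ha hg.val_mem
    have hd := hg.den_ne_zero
    refine ⟨ha, ?_, hg⟩
    have h1 := chain_step hc.2.1 h0 hd (Chain.coordinate hg hc.2.2 he)
    obtain ⟨p, q, hq, hp⟩ := hg.den_eq
    have hdi : (toComplex a + val L) * den L = toComplex (a * q + p) := by
      rw [add_mul, hp, hq]; simp
    have hpi : val (a :: L) * ((toComplex a + val L) * den L) = toComplex q := by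
      rw [val, inv_mul_cancel_left₀ h0, hq]
    have hne : (toComplex a + val L) * den L ≠ 0 := mul_ne_zero h0 hd
    have hint := integral_of_eq hdi hpi
    refine mem_closedSquare_of_close hc.1 hne hint ?_
    obtain ⟨N, _, _, hN, _⟩ := hint
    have hge := one_le_sq_norm_of_int hne hN
    have hge' := hg.one_le_norm_den
    have hoff := hg.norm_offset_le_sqrt
    set X := (-1) ^ L.length * e⁻¹ + offset L with hX
    set Y := -X - 1 / (den L * ((toComplex a + val L) * den L)) with hY
    have h2 : ‖z - (toComplex a + val L)⁻¹‖ * ‖(toComplex a + val L) * den L‖ ^ 2 * ‖Y‖ = 1 := by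
      rw [← norm_pow, ← norm_mul, ← norm_mul, h1, norm_one]
    have hs : Real.sqrt 2 ≤ 3 / 2 := by rw [Real.sqrt_le_iff]; norm_num
    have h3 : ‖e⁻¹‖ ≤ ‖X‖ + ‖offset L‖ := by
      have : ‖e⁻¹‖ = ‖X - offset L‖ := by
        rw [hX, add_sub_cancel_right, norm_mul, norm_pow, norm_neg, norm_one, one_pow, one_mul]
      rw [this]; exact norm_sub_le _ _
    have h4 : ‖X‖ ≤ ‖Y‖ + 1 := by
      have e1 : X = -Y - 1 / (den L * ((toComplex a + val L) * den L)) := by rw [hY]; ring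
      rw [e1]
      refine (norm_sub_le _ _).trans ?_
      rw [norm_neg]
      have : ‖1 / (den L * ((toComplex a + val L) * den L))‖ ≤ 1 := by
        rw [norm_div, norm_one, norm_mul]
        exact div_le_one_of_le₀ (by nlinarith) (by positivity)
      linarith
    -- From 8 one loses at most 3/2 through the offset and 1 through the new translation. The scaled
    -- distance is then at most 1/5, below the required 1/2.
    have h5 : 5 ≤ ‖Y‖ := by linarith
    have h6 : 0 ≤ ‖z - (toComplex a + val L)⁻¹‖ * ‖(toComplex a + val L) * den L‖ ^ 2 := by
      positivity
    rw [val]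
    nlinarith

/-! ### Nearby points belong to words with the same value. -/

lemma norm_eq_of_abs_eq {w v : ℂ} (h1 : |w.re| = |v.re|) (h2 : |w.im| = |v.im|) :
    ‖w‖ = ‖v‖ := by
  have h3 : ‖w‖ ^ 2 = ‖v‖ ^ 2 := by
    rw [sq_norm_eq, sq_norm_eq, ← sq_abs w.re, ← sq_abs w.im, h1, h2, sq_abs, sq_abs]
  exact (sq_eq_sq₀ (_root_.norm_nonneg w) (_root_.norm_nonneg v)).1 h3

/-- If x ≠ y, the two numbers are the opposite endpoints ±1/2: this is the tie that produces a
reflection. -/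
lemma abs_eq_of_sub_int {x y : ℝ} {k : ℤ} (hx : |x| ≤ 1 / 2) (hy : |y| ≤ 1 / 2)
    (h : x - y = k) : |x| = |y| := by
  rw [abs_le] at hx hy
  have h1 : k < 2 := by
    have : (k : ℝ) < 2 := by linarith
    exact_mod_cast this
  have h2 : -2 < k := by
    have : (-2 : ℝ) < k := by linarith
    exact_mod_cast this
  obtain rfl | rfl | rfl : k = -1 ∨ k = 0 ∨ k = 1 := by omega
  · have e1 : x = -(1 / 2) := by push_cast at h; linarith
    have e2 : y = 1 / 2 := by push_cast at h; linarith
    rw [e1, e2, abs_neg]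
  · have : x = y := by push_cast at h; linarith
    rw [this]
  · have e1 : x = 1 / 2 := by push_cast at h; linarith
    have e2 : y = -(1 / 2) := by push_cast at h; linarith
    rw [e1, e2, abs_neg]

lemma exists_int_of_reflected {R y N : ℝ} {a b n m : ℤ} (hR : |R| = |(a : ℝ) + y|)
    (hN : N = n) (hm : N * y = m) : ∃ k : ℤ, N * (R - b) = k := by
  rcases abs_eq_abs.1 hR with h | h
  · exact ⟨n * a + m - n * b, by push_cast; rw [h, ← hm, ← hN]; ring⟩
  · exact ⟨-(n * a + m) - n * b, by push_cast; rw [h, ← hm, ← hN]; ring⟩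

lemma abs_eq_of_reflected {R y : ℝ} {a b : ℤ} (hR : |R| = |(a : ℝ) + y|)
    (hx : |R - b| ≤ 1 / 2) (hy : |y| ≤ 1 / 2) : |R - b| = |y| := by
  rcases abs_eq_abs.1 hR with h | h
  · exact abs_eq_of_sub_int (k := a - b) hx hy (by push_cast; linarith)
  · rw [← abs_neg y] at hy ⊢
    exact abs_eq_of_sub_int (k := -a - b) hx hy (by push_cast; linarith)

lemma abs_inv_re_eq {w v : ℂ} (h1 : |w.re| = |v.re|) (h2 : |w.im| = |v.im|) :
    |w⁻¹.re| = |v⁻¹.re| ∧ |w⁻¹.im| = |v⁻¹.im| := by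
  have h3 : Complex.normSq w = Complex.normSq v := by
    rw [← Complex.sq_norm, ← Complex.sq_norm, norm_eq_of_abs_eq h1 h2]
  simp only [Complex.inv_re, Complex.inv_im, abs_div, abs_neg, h1, h2, h3, and_self]

/-- The distance estimate propagates along the two continued fraction expansions. -/
lemma propagate {δ δ' x y nw nz : ℝ} (hy : 1 ≤ y) (hxy : Real.sqrt 2 * y ≤ x)
    (hw : y = nw * x) (hw0 : 0 < nw) (hz0 : 0 < nz) (hδ : 0 ≤ δ) (hz : nw ≤ nz + δ)
    (hδ' : δ' * (nz * nw) = δ)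
    (h : δ * x ^ 2 * (4 + Real.sqrt 2 * (1 - 1 / x ^ 2)) ≤ 1) :
    δ' * y ^ 2 * (4 + Real.sqrt 2 * (1 - 1 / y ^ 2)) ≤ 1 := by
  have hy0 : 0 < y := by linarith
  have hx0 : 0 < x := lt_of_lt_of_le (by positivity) hxy
  have hg := gap_bound hy0 hxy
  set A := 4 + Real.sqrt 2 * (1 - 1 / x ^ 2) with hA
  set B := 4 + Real.sqrt 2 * (1 - 1 / y ^ 2) with hB
  have hAB : B + 1 / (y * x) ≤ A := by
    have e1 : Real.sqrt 2 / y ^ 2 = Real.sqrt 2 * (1 / y ^ 2) := by ring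
    have e2 : Real.sqrt 2 / x ^ 2 = Real.sqrt 2 * (1 / x ^ 2) := by ring
    rw [e1, e2] at hg
    rw [hA, hB]; linarith
  -- The surplus 1/(yx) contributes exactly δ on the left, which pays for replacing `nw` by `nz +
  -- δ`.
  have h1 : δ * (y * x) * (B + 1 / (y * x)) ≤ nw := by
    have h2 : δ * (y * x) * (B + 1 / (y * x)) ≤ δ * (y * x) * A :=
      mul_le_mul_of_nonneg_left hAB (by positivity)
    have h3 : δ * (y * x) * A = nw * (δ * x ^ 2 * A) := by rw [hw]; ring
    have h4 : nw * (δ * x ^ 2 * A) ≤ nw * 1 := mul_le_mul_of_nonneg_left h hw0.le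
    linarith
  have h5 : δ * (y * x) * (B + 1 / (y * x)) = δ * (y * x) * B + δ := by
    field_simp
  have h6 : δ' * y ^ 2 * B * nz = δ * (y * x) * B := by
    rw [← hδ', hw]; ring
  have h7 : δ' * y ^ 2 * B * nz ≤ 1 * nz := by linarith
  exact le_of_mul_le_mul_right h7 hz0

/-- If `z` is close to the value of the good word `L`, relative to its denominator, then the word
of the same length along which `z` moves has the same value, up to the reflections that come from
ties in the choice of the nearest integer. -/
lemma Good.val_eq_of_close_aux : ∀ {L M : List GaussianInt}, L.length = M.length → Good L →
    ∀ {z e w : ℂ}, Chain closedSquare z M e → |w.re| = |(val L).re| → |w.im| = |(val L).im| →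
      ‖z - w‖ * ‖den L‖ ^ 2 * (4 + Real.sqrt 2 * (1 - 1 / ‖den L‖ ^ 2)) ≤ 1 →
      val M = w ∧ ‖den M‖ = ‖den L‖ := by
  intro L
  induction L with
  | nil =>
    intro M hlen _ z e w _ h1 h2 _
    obtain rfl : M = [] := List.eq_nil_of_length_eq_zero hlen.symm
    simp only [val, Complex.zero_re, abs_zero, abs_eq_zero, Complex.zero_im] at h1 h2
    exact ⟨(Complex.ext h1 h2).symm, rfl⟩
  | cons a L ih =>
    intro M hlen hg z e w hc h1 h2 h3
    obtain _ | ⟨b, M⟩ := M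
    · simp at hlen
    have hnw := norm_eq_of_abs_eq h1 h2
    have ha0 := hg.head_add_ne_zero
    have hL := hg.2.2
    have hv0 : val (a :: L) ≠ 0 := inv_ne_zero ha0
    have hw0 : 0 < ‖w‖ := by rw [hnw]; exact norm_pos_iff.2 hv0
    have hw : w ≠ 0 := norm_pos_iff.1 hw0
    have hz : z ≠ 0 := hc.2.1
    obtain ⟨r1, r2⟩ := abs_inv_re_eq h1 h2
    have hq : ‖den L‖ = ‖w‖ * ‖den (a :: L)‖ := by
      rw [hnw, ← norm_mul, val, den, inv_mul_cancel_left₀ ha0]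
    rw [val, inv_inv] at r1 r2
    simp only [Complex.add_re, Complex.add_im, ← intCast_re, ← intCast_im] at r1 r2
    have hprop := propagate (δ' := ‖(z⁻¹ - toComplex b) - (w⁻¹ - toComplex b)‖)
      hL.one_le_norm_den hg.norm_den_tail hq hw0 (norm_pos_iff.2 hz)
      (norm_nonneg (z - w)) (by
        have := norm_sub_le z (z - w)
        rwa [sub_sub_cancel] at this) (by
        rw [← norm_mul, ← norm_mul, sub_sub_sub_cancel_right, ← norm_neg]
        congr 1
        field_simp
        ring) h3
    -- The digit b is dictated by z, not by w. The image of w stays in the square because it is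
    -- rational with denominator |`den L`|² and close to the image of z.
    have hmem : w⁻¹ - toComplex b ∈ closedSquare := by
      refine mem_closedSquare_of_close hc.2.2.start_mem hL.den_ne_zero ?_ ?_ (d := den L)
      · obtain ⟨N, m, k, hN, hm, hk⟩ := hL.integral
        rw [hN]
        obtain ⟨m', hm'⟩ := exists_int_of_reflected (b := b.re) r1 rfl hm
        obtain ⟨k', hk'⟩ := exists_int_of_reflected (b := b.im) r2 rfl hk
        refine ⟨N, m', k', rfl, ?_, ?_⟩
        · rw [← hm', Complex.sub_re, ← intCast_re]
        · rw [← hk', Complex.sub_im, ← intCast_im]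
      · have h4 : 4 ≤ 4 + Real.sqrt 2 * (1 - 1 / ‖den L‖ ^ 2) := by
          have h5 : 1 / ‖den L‖ ^ 2 ≤ 1 :=
            div_le_one_of_le₀ (one_le_pow₀ hL.one_le_norm_den) (by positivity)
          have := mul_nonneg (Real.sqrt_nonneg 2) (sub_nonneg.2 h5)
          linarith
        have h5 : 0 ≤ ‖(z⁻¹ - toComplex b) - (w⁻¹ - toComplex b)‖ * ‖den L‖ ^ 2 := by positivity
        nlinarith
    obtain ⟨i1, i2⟩ := ih (by simpa using hlen) hL hc.2.2
      (by
        have := hmem.1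
        rw [Complex.sub_re, ← intCast_re] at this ⊢
        exact abs_eq_of_reflected r1 this hL.val_mem.1)
      (by
        have := hmem.2
        rw [Complex.sub_im, ← intCast_im] at this ⊢
        exact abs_eq_of_reflected r2 this hL.val_mem.2) hprop
    refine ⟨?_, ?_⟩
    · rw [val, i1, add_sub_cancel, inv_inv]
    · rw [den, i1, add_sub_cancel, norm_mul, norm_inv, i2, hq, inv_mul_cancel_left₀ hw0.ne']

lemma Good.val_eq_of_close {L M : List GaussianInt} (hlen : L.length = M.length) (h : Good L)
    {z e : ℂ} (hc : Chain closedSquare z M e) (hz : 8 * (‖z - val L‖ * ‖den L‖ ^ 2) ≤ 1) :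
    val M = val L ∧ ‖den M‖ = ‖den L‖ := by
  refine h.val_eq_of_close_aux hlen hc rfl rfl (le_trans ?_ hz)
  rw [mul_comm]
  refine mul_le_mul_of_nonneg_right ?_ (by positivity)
  have h1 : Real.sqrt 2 ≤ 2 := by rw [Real.sqrt_le_iff]; norm_num
  have h2 : 0 ≤ 1 / ‖den L‖ ^ 2 := by positivity
  nlinarith [Real.sqrt_nonneg 2]

/-! ### Boundary curves of the square and their images under inversion. -/

/-- The four units of the Gaussian integers. -/
def IsUnitGauss (γ : GaussianInt) : Prop := γ.re ^ 2 + γ.im ^ 2 = 1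

lemma IsUnitGauss.cases {γ : GaussianInt} (h : IsUnitGauss γ) :
    γ = ⟨1, 0⟩ ∨ γ = ⟨-1, 0⟩ ∨ γ = ⟨0, 1⟩ ∨ γ = ⟨0, -1⟩ := by
  obtain ⟨x, y⟩ := γ
  simp only [IsUnitGauss] at h
  have h1 : x ≤ 1 := by nlinarith
  have h2 : -1 ≤ x := by nlinarith
  have h3 : y ≤ 1 := by nlinarith
  have h4 : -1 ≤ y := by nlinarith
  simp only [Zsqrtd.mk.injEq]
  interval_cases x <;> interval_cases y <;> simp_all

lemma IsUnitGauss.neg {γ : GaussianInt} (h : IsUnitGauss γ) : IsUnitGauss (-γ) := by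
  simpa [IsUnitGauss] using h

lemma IsUnitGauss.star {γ : GaussianInt} (h : IsUnitGauss γ) : IsUnitGauss (star γ) := by
  simpa [IsUnitGauss] using h

lemma isUnitGauss_iff_norm {γ : GaussianInt} : IsUnitGauss γ ↔ ‖toComplex γ‖ = 1 := by
  rw [← sq_eq_sq₀ (_root_.norm_nonneg _) zero_le_one, sq_norm_eq, ← intCast_re, ← intCast_im,
    IsUnitGauss]
  norm_cast

lemma IsUnitGauss.conj_mul {γ : GaussianInt} (h : IsUnitGauss γ) :
    conj (toComplex γ) * toComplex γ = 1 := by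
  rw [Complex.conj_mul', isUnitGauss_iff_norm.1 h]; simp

/-- Two Gaussian integers whose sum has max norm at most one. -/
def Near (β p : GaussianInt) : Prop := |β.re + p.re| ≤ 1 ∧ |β.im + p.im| ≤ 1

/-- `N` is the unit normal at `w` of a boundary curve through `w` of the region that contains `z`:
either a side of the unit square, or a unit circle around a Gaussian integer `β` that the previous
digit `p` takes to a neighbour of `0`. -/
def Tangent (p : GaussianInt) (z w N : ℂ) : Prop :=
  (∃ γ : GaussianInt, IsUnitGauss γ ∧ (conj (toComplex γ) * w).re = 1 / 2 ∧ N = toComplex γ) ∨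
  ∃ β : GaussianInt, Near β p ∧ N = toComplex β - w ∧ ‖N‖ = 1 ∧ 1 ≤ ‖z - toComplex β‖

lemma abs_re_conj_mul_lt {γ : GaussianInt} (h : IsUnitGauss γ) {z : ℂ} (hz : z ∈ openSquare) :
    |(toComplex γ * z).re| < 1 / 2 := by
  rcases h.cases with rfl | rfl | rfl | rfl <;>
    simp [toComplex_def', abs_neg, -one_div, hz.1, hz.2]

lemma abs_re_conj_mul_le {γ : GaussianInt} (h : IsUnitGauss γ) {z : ℂ}
    (hz : z ∈ closedSquare) : |(toComplex γ * z).re| ≤ 1 / 2 := by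
  rcases h.cases with rfl | rfl | rfl | rfl <;>
    simp [toComplex_def', abs_neg, -one_div, hz.1, hz.2]

lemma normSq_eq_of_norm_eq_one {β w : ℂ} (h : ‖β - w‖ = 1) :
    (β.re - w.re) ^ 2 + (β.im - w.im) ^ 2 = 1 := by
  have := sq_norm_eq (β - w)
  rw [h] at this
  simpa using this.symm

lemma coord_le_one {x : ℤ} {w : ℝ} (hw : |w| ≤ 1 / 2) (h : ((x : ℝ) - w) ^ 2 ≤ 1) : |x| ≤ 1 := by
  rw [abs_le] at hw ⊢
  have h1 : (x : ℝ) < 2 := by nlinarith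
  have h2 : (-2 : ℝ) < x := by nlinarith
  have h1' : x < 2 := by exact_mod_cast h1
  have h2' : -2 < x := by exact_mod_cast h2
  omega

lemma sq_norm_sub_one_le_iff {z β : ℂ} :
    1 ≤ ‖z - β‖ ↔ 1 ≤ (z.re - β.re) ^ 2 + (z.im - β.im) ^ 2 := by
  rw [← one_le_sq_iff₀ (_root_.norm_nonneg _), sq_norm_eq]; simp

lemma sq_dist_sub_one {z β : ℂ} (hz : z ≠ 0) :
    (z.re - β.re) ^ 2 + (z.im - β.im) ^ 2 - 1 =
      ‖z‖ ^ 2 * (1 - 2 * (β * z⁻¹).re + (‖β‖ ^ 2 - 1) * ‖z⁻¹‖ ^ 2) := by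
  have hz' : 0 < ‖z‖ := norm_pos_iff.2 hz
  have h2 : ‖z‖ ^ 2 * (β * z⁻¹).re = β.re * z.re + β.im * z.im := by
    have h4 : (β * conj z).re = β.re * z.re + β.im * z.im := by simp
    rw [← h4, ← Complex.re_ofReal_mul]
    congr 1
    push_cast
    rw [← Complex.mul_conj']
    field_simp
  have h3 : ‖z‖ ^ 2 * ‖z⁻¹‖ ^ 2 = 1 := by
    rw [norm_inv]; field_simp
  linear_combination (-1) * sq_norm_eq z - sq_norm_eq β + 2 * h2 - (‖β‖ ^ 2 - 1) * h3

/-- The region `1 ≤ |z - β|` in the coordinate `z⁻¹`. -/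
lemma inv_region {z β : ℂ} (hz : z ≠ 0) :
    1 ≤ ‖z - β‖ ↔ 0 ≤ 1 - 2 * (β * z⁻¹).re + (‖β‖ ^ 2 - 1) * ‖z⁻¹‖ ^ 2 := by
  have hz' : 0 < ‖z‖ ^ 2 := by have := norm_pos_iff.2 hz; positivity
  rw [sq_norm_sub_one_le_iff, ← sub_nonneg, sq_dist_sub_one hz, mul_nonneg_iff_of_pos_left hz']

/-- Inversion takes a side of the square to a unit circle around a unit, a unit circle around a unit
to a line, and a unit circle around a β with |β|² = 2 to another such circle. The normal is rotated
by the direction of the derivative -1/w². -/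
lemma Tangent.step {p a : GaussianInt} {z w N : ℂ} (h : Tangent p z w N) (hz : z ≠ 0)
    (hw : w ≠ 0) (hzo : z ∈ openSquare) (hwc : w ∈ closedSquare)
    (hz' : z⁻¹ - toComplex a ∈ openSquare) (hw' : w⁻¹ - toComplex a ∈ closedSquare) :
    Tangent a (z⁻¹ - toComplex a) (w⁻¹ - toComplex a) (-N * conj w / w) := by
  have hnorm : ‖N‖ = 1 → ‖-N * conj w / w‖ = 1 := by
    intro hN
    rw [norm_div, norm_mul, norm_neg, hN, RCLike.norm_conj, one_mul,
      div_self (norm_ne_zero_iff.2 hw)]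
  rcases h with ⟨γ, hγ, hγw, rfl⟩ | ⟨β, -, rfl, hN, hzβ⟩
  · right
    refine ⟨star γ - a, ?_, ?_, hnorm (isUnitGauss_iff_norm.1 hγ), ?_⟩
    · rcases hγ.cases with rfl | rfl | rfl | rfl <;> simp [Near]
    · rw [toComplex_sub, toComplex_star, sub_sub_sub_cancel_right]
      field_simp
      apply Complex.ext
      · simp at hγw ⊢; linarith
      · simp; ring
    · rw [toComplex_sub, sub_sub_sub_cancel_right, inv_region (inv_ne_zero hz), inv_inv,
        isUnitGauss_iff_norm.1 hγ.star, toComplex_star]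
      have h1 := abs_re_conj_mul_lt hγ.star hzo
      rw [toComplex_star] at h1
      have := (abs_lt.1 h1).2
      linarith
  · have hn := normSq_eq_of_norm_eq_one hN
    rw [← intCast_re, ← intCast_im] at hn
    have hx : |β.re| ≤ 1 := coord_le_one hwc.1 (by nlinarith)
    have hy : |β.im| ≤ 1 := coord_le_one hwc.2 (by nlinarith)
    have hwn := sq_norm_le_of_mem_closedSquare hwc
    rw [sq_norm_eq] at hwn
    have hs : β.re ^ 2 + β.im ^ 2 = 0 ∨ β.re ^ 2 + β.im ^ 2 = 1 ∨ β.re ^ 2 + β.im ^ 2 = 2 := by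
      have h1 : β.re ^ 2 ≤ 1 := (sq_le_one_iff_abs_le_one _).2 hx
      have h2 : β.im ^ 2 ≤ 1 := (sq_le_one_iff_abs_le_one _).2 hy
      have := sq_nonneg β.re
      have := sq_nonneg β.im
      omega
    have hβn : ‖toComplex β‖ ^ 2 = ((β.re ^ 2 + β.im ^ 2 : ℤ) : ℝ) := by
      rw [sq_norm_eq, ← intCast_re, ← intCast_im]; push_cast; rfl
    rcases hs with hs | hs | hs
    -- The centre 0 is impossible, as w has squared modulus at most 1/2.
    · exfalso
      have h1 : β.re = 0 := by nlinarith
      have h2 : β.im = 0 := by nlinarith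
      rw [h1, h2] at hn
      simp at hn
      linarith
    · left
      have hβ : IsUnitGauss β := hs
      have hsR : (β.re : ℝ) ^ 2 + (β.im : ℝ) ^ 2 = 1 := by exact_mod_cast hs
      have hw1 : (toComplex β * w⁻¹).re = 1 / 2 := by
        have h1 := sq_dist_sub_one (β := toComplex β) hw
        rw [hβn, hs, ← intCast_re, ← intCast_im] at h1
        have h2 : 0 < ‖w‖ ^ 2 := by have := norm_pos_iff.2 hw; positivity
        have h3 : ‖w‖ ^ 2 * (1 - 2 * (toComplex β * w⁻¹).re) = 0 := by
          push_cast at h1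
          linarith
        have := (mul_eq_zero.1 h3).resolve_left h2.ne'
        linarith
      have hz1 : (toComplex β * z⁻¹).re ≤ 1 / 2 := by
        have h1 := (inv_region hz).1 hzβ
        rw [hβn, hs] at h1
        push_cast at h1
        linarith
      have hk : (toComplex β * toComplex a).re = (((β * a).re : ℤ) : ℝ) := by
        rw [intCast_re, toComplex_mul]
      have h1 := abs_le.1 (abs_re_conj_mul_le hβ hw')
      have h2 := abs_lt.1 (abs_re_conj_mul_lt hβ hz')
      rw [mul_sub, Complex.sub_re, hk] at h1 h2
      -- The point w leaves the values 0 and 1. The value 1 would push z to or beyond the opposite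
      -- side, which the open square forbids.
      have hk0 : (β * a).re = 0 := by
        have h3 : ((β * a).re : ℝ) < 1 := by linarith [h2.1]
        have h4 : (-1 : ℝ) < (β * a).re := by linarith [h1.2]
        have h3' : (β * a).re < 1 := by exact_mod_cast h3
        have h4' : -1 < (β * a).re := by exact_mod_cast h4
        omega
      refine ⟨star β, hβ.star, ?_, ?_⟩
      · rw [toComplex_star, Complex.conj_conj, mul_sub, Complex.sub_re, hk, hk0, hw1]; simp
      · rw [toComplex_star, div_eq_iff hw]
        apply Complex.ext
        · simp [← intCast_re, ← intCast_im]; linarith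
        · simp [← intCast_re, ← intCast_im]; linarith
    · right
      have hsR : (β.re : ℝ) ^ 2 + (β.im : ℝ) ^ 2 = 2 := by exact_mod_cast hs
      refine ⟨star β - a, ?_, ?_, hnorm hN, ?_⟩
      · simpa [Near] using ⟨hx, hy⟩
      · rw [toComplex_sub, toComplex_star, sub_sub_sub_cancel_right]
        field_simp
        apply Complex.ext
        · simp [← intCast_re, ← intCast_im]; linarith
        · simp [← intCast_re, ← intCast_im]; linarith
      · rw [toComplex_sub, sub_sub_sub_cancel_right, inv_region (inv_ne_zero hz), inv_inv,
          toComplex_star, RCLike.norm_conj, hβn, hs]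
        have h1 := (sq_norm_sub_one_le_iff).1 hzβ
        rw [← intCast_re, ← intCast_im] at h1
        have h2 : (conj (toComplex β) * z).re = β.re * z.re + β.im * z.im := by
          simp [← intCast_re, ← intCast_im]
        rw [h2, sq_norm_eq]
        push_cast
        linarith

/-- A boundary curve through the value of a good word becomes, at the end of the word, a unit
circle through `0` around a unit. -/
lemma Tangent.exists_unit {L : List GaussianInt} (hL : Good L) :
    ∀ {p : GaussianInt} {z e N : ℂ}, Chain openSquare z L e → Tangent p z (val L) N →
      ∃ β : GaussianInt, IsUnitGauss β ∧ Near β (L.getLastD p) ∧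
        toComplex β * (‖den L‖ : ℂ) ^ 2 = (-1) ^ L.length * N * den L ^ 2 := by
  induction L with
  | nil =>
    intro p z e N hc ht
    -- The value of the empty word is 0, which lies on no side of the square, so only a circle
    -- remains. The last digit is then the preceding digit p, the default in `getLastD`.
    rcases ht with ⟨γ, _, h, _⟩ | ⟨β, h1, rfl, h3, _⟩
    · simp [val] at h
    · rw [val, sub_zero] at h3
      exact ⟨β, isUnitGauss_iff_norm.2 h3, h1, by simp [val, den]⟩
  | cons a L ih =>
    intro p z e N hc ht
    have h0 := hL.head_add_ne_zero
    have hw : val (a :: L) ≠ 0 := inv_ne_zero h0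
    have hv : (val (a :: L))⁻¹ - toComplex a = val L := by simp [val]
    have h1 := ht.step (a := a) hc.2.1 hw hc.1 hL.val_mem hc.2.2.start_mem
      (by rw [hv]; exact hL.2.2.val_mem)
    rw [hv] at h1
    obtain ⟨β, hβ, hn, he⟩ := ih hL.2.2 hc.2.2 h1
    refine ⟨β, hβ, by rw [List.getLastD_cons]; exact hn, ?_⟩
    have hd : den L = val (a :: L) * den (a :: L) := by
      rw [val, den, inv_mul_cancel_left₀ h0]
    rw [hd, norm_mul, Complex.ofReal_mul, mul_pow, ← Complex.conj_mul'] at he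
    have hcw : conj (val (a :: L)) ≠ 0 := by simpa using hw
    rw [List.length_cons, pow_succ]
    field_simp at he
    linear_combination he

/-! ### Ties and the separation of words with a common value. -/

lemma tie_coordinate {x y : ℝ} {k : ℤ} (hx : |x| ≤ 1 / 2) (hy : |y| ≤ 1 / 2) (h : x - y = k)
    (hk : k ≠ 0) : (k = 1 ∨ k = -1) ∧ k * x = 1 / 2 ∧ k * y = -(1 / 2) := by
  rw [abs_le] at hx hy
  have h1 : k < 2 := by
    have : (k : ℝ) < 2 := by linarith
    exact_mod_cast this
  have h2 : -2 < k := by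
    have : (-2 : ℝ) < k := by linarith
    exact_mod_cast this
  obtain rfl | rfl : k = -1 ∨ k = 1 := by omega
  · refine ⟨Or.inr rfl, ?_, ?_⟩ <;> push_cast at * <;> linarith
  · refine ⟨Or.inl rfl, ?_, ?_⟩ <;> push_cast at * <;> linarith

/-- Two points of the closed square that differ by a Gaussian integer lie on opposite sides. -/
lemma exists_tie {v w : ℂ} {g : GaussianInt} (hv : v ∈ closedSquare) (hw : w ∈ closedSquare)
    (h : v - w = toComplex g) (hg : g ≠ 0) :
    ∃ γ : GaussianInt, IsUnitGauss γ ∧ (conj (toComplex γ) * v).re = 1 / 2 ∧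
      (conj (toComplex (-γ)) * w).re = 1 / 2 := by
  have hr : v.re - w.re = g.re := by rw [intCast_re, ← h]; simp
  have hi : v.im - w.im = g.im := by rw [intCast_im, ← h]; simp
  by_cases h0 : g.re = 0
  · have h1 : g.im ≠ 0 := fun h1 => hg (Zsqrtd.ext h0 h1)
    obtain ⟨h2, h3, h4⟩ := tie_coordinate hv.2 hw.2 hi h1
    refine ⟨⟨0, g.im⟩, ?_, ?_, ?_⟩
    · rcases h2 with h2 | h2 <;> simp [IsUnitGauss, h2]
    · simpa [toComplex_def'] using h3
    · rw [intCast_im] at h4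
      simp [toComplex_def', toComplex_neg, -one_div]; linarith
  · obtain ⟨h2, h3, h4⟩ := tie_coordinate hv.1 hw.1 hr h0
    refine ⟨⟨g.re, 0⟩, ?_, ?_, ?_⟩
    · rcases h2 with h2 | h2 <;> simp [IsUnitGauss, h2]
    · simpa [toComplex_def'] using h3
    · rw [intCast_re] at h4
      simp [toComplex_def', toComplex_neg, -one_div]; linarith

lemma neg_one_pow_mul_self (n : ℕ) : ((-1 : ℂ) ^ n) * (-1) ^ n = 1 := by
  rw [← mul_pow]; simp

/-- The points that move along `L` lie on one side of a tie, which gives a half-plane for the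
coordinate at the end of the chain. -/
lemma Good.re_mul_inv_le {L : List GaussianInt} (hL : Good L) {γ β : GaussianInt}
    (hγ : IsUnitGauss γ) (hγw : (conj (toComplex γ) * val L).re = 1 / 2) (hβ : IsUnitGauss β)
    (h : toComplex β * (‖den L‖ : ℂ) ^ 2 = (-1) ^ L.length * toComplex γ * den L ^ 2)
    {z e : ℂ} (hc : Chain closedSquare z L e) (he : e ≠ 0) :
    (toComplex β * e⁻¹).re ≤ Real.sqrt 2 := by
  have h1 := hc.coordinate hL he
  have hs := hL.norm_offset_le_sqrt
  have hσ := neg_one_pow_mul_self L.length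
  have hσn : ‖(-1 : ℂ) ^ L.length‖ = 1 := by simp
  have hd : 0 < ‖den L‖ ^ 2 := by have := norm_pos_iff.2 hL.den_ne_zero; positivity
  have hz := (abs_le.1 (abs_re_conj_mul_le hγ.star hc.start_mem)).2
  rw [toComplex_star] at hz
  have hβn := isUnitGauss_iff_norm.1 hβ
  generalize (-1 : ℂ) ^ L.length = σ at *
  generalize offset L = s at *
  generalize val L = w at *
  generalize den L = q at *
  set X := σ * e⁻¹ + s with hX
  have hzw : z - w ≠ 0 := by
    rintro h0
    rw [h0] at h1
    simp at h1
  have hq : q ^ 2 * X = (z - w)⁻¹ := by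
    refine eq_inv_of_mul_eq_one_left ?_
    linear_combination h1
  have h2 : ‖q‖ ^ 2 * (toComplex β * σ * X).re = (toComplex γ * (z - w)⁻¹).re := by
    rw [← Complex.re_ofReal_mul, ← hq]
    congr 1
    push_cast
    linear_combination (σ * X) * h + toComplex γ * q ^ 2 * X * hσ
  -- Inversion about w maps the half-plane behind the side through w to a half-plane bounded by a
  -- line through 0.
  have h3 : ‖z - w‖ ^ 2 * (toComplex γ * (z - w)⁻¹).re ≤ 0 := by
    have h4 : ‖z - w‖ ^ 2 * (toComplex γ * (z - w)⁻¹).re =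
        (conj (toComplex γ) * z).re - (conj (toComplex γ) * w).re := by
      rw [← Complex.sub_re, ← mul_sub, ← Complex.re_ofReal_mul]
      have : (((‖z - w‖ ^ 2 : ℝ) : ℂ) * (toComplex γ * (z - w)⁻¹)) =
          conj (conj (toComplex γ) * (z - w)) := by
        rw [map_mul, Complex.conj_conj]
        push_cast
        rw [← Complex.mul_conj']
        field_simp
      rw [this, Complex.conj_re]
    rw [h4]; linarith
  have h5 : (toComplex γ * (z - w)⁻¹).re ≤ 0 := by
    have : 0 < ‖z - w‖ ^ 2 := by have := norm_pos_iff.2 hzw; positivity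
    exact nonpos_of_mul_nonpos_right h3 this
  have h6 : (toComplex β * σ * X).re ≤ 0 := by
    rw [← h2] at h5
    exact nonpos_of_mul_nonpos_right h5 hd
  have h7 : toComplex β * e⁻¹ = toComplex β * σ * X - toComplex β * σ * s := by
    rw [hX]; linear_combination (-(toComplex β * e⁻¹)) * hσ
  have h8 : -(toComplex β * σ * s).re ≤ ‖s‖ := by
    refine (neg_le_abs _).trans ((Complex.abs_re_le_norm _).trans ?_)
    rw [norm_mul, norm_mul, hβn, hσn]; simp
  rw [h7, Complex.sub_re]
  linarith

/-- Two different good words with the same value are separated by a line. -/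
lemma exists_separation : ∀ {L M : List GaussianInt}, L.length = M.length → L ≠ M → Good L →
    Good M → val L = val M → ‖den L‖ = ‖den M‖ → ∀ {z e z' e' : ℂ} {p : GaussianInt},
    Chain openSquare z L e → Chain openSquare z' M e' →
    ∃ β δ : GaussianInt, IsUnitGauss β ∧ IsUnitGauss δ ∧ Near β (L.getLastD p) ∧
      Near δ (M.getLastD p) ∧ toComplex β * den M ^ 2 = -(toComplex δ * den L ^ 2) ∧
      (∀ {x y : ℂ}, Chain closedSquare x L y → y ≠ 0 → (toComplex β * y⁻¹).re ≤ Real.sqrt 2) ∧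
      ∀ {x y : ℂ}, Chain closedSquare x M y → y ≠ 0 → (toComplex δ * y⁻¹).re ≤ Real.sqrt 2 := by
  intro L
  induction L with
  | nil =>
    intro M hlen hne
    exact absurd (List.eq_nil_of_length_eq_zero hlen.symm).symm hne
  | cons a L ih =>
    intro M hlen hne hL hM hval hden z e z' e' p hc hc'
    obtain _ | ⟨b, M⟩ := M
    · simp at hlen
    have hlen' : L.length = M.length := by simpa using hlen
    have hv : toComplex a + val L = toComplex b + val M := inv_injective hval
    have ha0 := hL.head_add_ne_zero
    have hd : ‖den L‖ = ‖den M‖ := by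
      rw [den, den, norm_mul, norm_mul, ← hv] at hden
      exact mul_left_cancel₀ (norm_ne_zero_iff.2 ha0) hden
    have key : ∃ β δ : GaussianInt, IsUnitGauss β ∧ IsUnitGauss δ ∧ Near β (L.getLastD a) ∧
      Near δ (M.getLastD b) ∧ toComplex β * den M ^ 2 = -(toComplex δ * den L ^ 2) ∧
      (∀ {x y : ℂ}, Chain closedSquare x L y → y ≠ 0 → (toComplex β * y⁻¹).re ≤ Real.sqrt 2) ∧
      ∀ {x y : ℂ}, Chain closedSquare x M y → y ≠ 0 →
        (toComplex δ * y⁻¹).re ≤ Real.sqrt 2 := by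
      by_cases hab : a = b
      · subst hab
        exact ih hlen' (fun h => hne (by rw [h])) hL.2.2 hM.2.2 (add_left_cancel hv) hd
          hc.2.2 hc'.2.2
      -- At the first differing digit the tails have values differing by a nonzero Gaussian integer.
      -- The sides through them have opposite normals γ and -γ, whence the minus sign in the
      -- relation between β and δ.
      · obtain ⟨γ, hγ, hγ1, hγ2⟩ := exists_tie (g := b - a) hL.2.2.val_mem hM.2.2.val_mem
          (by rw [toComplex_sub]; linear_combination hv)
          (sub_ne_zero.2 (Ne.symm hab))
        obtain ⟨β, hβ, hβn, hβe⟩ := Tangent.exists_unit hL.2.2 (p := a) hc.2.2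
          (Or.inl ⟨γ, hγ, hγ1, rfl⟩)
        obtain ⟨δ, hδ, hδn, hδe⟩ := Tangent.exists_unit hM.2.2 (p := b) hc'.2.2
          (Or.inl ⟨-γ, hγ.neg, hγ2, rfl⟩)
        refine ⟨β, δ, hβ, hδ, hβn, hδn, ?_, fun h1 h2 => hL.2.2.re_mul_inv_le hγ hγ1 hβ hβe h1 h2,
          fun h1 h2 => hM.2.2.re_mul_inv_le hγ.neg hγ2 hδ hδe h1 h2⟩
        have hq : ((‖den M‖ : ℂ)) ^ 2 ≠ 0 := by
          have := norm_ne_zero_iff.2 hM.2.2.den_ne_zero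
          exact_mod_cast pow_ne_zero 2 this
        rw [hd, hlen'] at hβe
        rw [toComplex_neg] at hδe
        apply mul_left_cancel₀ hq
        linear_combination den M ^ 2 * hβe + den L ^ 2 * hδe
    obtain ⟨β, δ, hβ, hδ, hβn, hδn, he, h1, h2⟩ := key
    refine ⟨β, δ, hβ, hδ, by rw [List.getLastD_cons]; exact hβn,
      by rw [List.getLastD_cons]; exact hδn, ?_, fun k1 k2 => h1 k1.2.2 k2,
      fun k1 k2 => h2 k1.2.2 k2⟩
    rw [den, den, ← hv]
    linear_combination (toComplex a + val L) ^ 2 * he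

/-- If β and -β were both near -g, the coordinate of g along β would vanish and the other would be
at most 1 in modulus, so that |g| ≤ 1. -/
lemma not_near_opposite {β δ g : GaussianInt} (hβ : IsUnitGauss β)
    (hg : Real.sqrt 2 ≤ ‖toComplex g‖) (h1 : Near β g) (h2 : Near δ g) : β ≠ -δ := by
  intro h
  obtain rfl : δ = -β := by rw [h, neg_neg]
  have h3 : (2 : ℝ) ≤ ((g.re ^ 2 + g.im ^ 2 : ℤ) : ℝ) := by
    have e : ‖toComplex g‖ ^ 2 = ((g.re ^ 2 + g.im ^ 2 : ℤ) : ℝ) := by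
      rw [sq_norm_eq, ← intCast_re, ← intCast_im]; push_cast; rfl
    rw [← e]
    exact (Real.sqrt_le_left (by positivity)).1 hg
  have h4 : 2 ≤ g.re ^ 2 + g.im ^ 2 := by exact_mod_cast h3
  obtain ⟨x, y⟩ := g
  simp only [Near, Zsqrtd.re_neg, Zsqrtd.im_neg, abs_le] at h1 h2 h4
  rcases hβ.cases with rfl | rfl | rfl | rfl
  all_goals
    simp only at h1 h2
    have hx : x = -1 ∨ x = 0 ∨ x = 1 := by omega
    have hy : y = -1 ∨ y = 0 ∨ y = 1 := by omega
    rcases hx with rfl | rfl | rfl <;> rcases hy with rfl | rfl | rfl <;> omega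

/-! ### Three words cannot be pairwise separated. -/

lemma axis_of_large {η x y : ℂ} (hη : η = 1 ∨ η = -1 ∨ η = Complex.I ∨ η = -Complex.I)
    (h1 : (η * x).re ≤ 3) (h2 : (-η * y).re ≤ 3) :
    (3 < x.re ∧ 3 < y.re ∨ x.re < -3 ∧ y.re < -3 → η = Complex.I ∨ η = -Complex.I) ∧
      (3 < x.im ∧ 3 < y.im ∨ x.im < -3 ∧ y.im < -3 → η = 1 ∨ η = -1) := by
  rcases hη with rfl | rfl | rfl | rfl
  all_goals
    simp at h1 h2
    constructor
    all_goals
      first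
      | (intro; simp; done)
      | (rintro (⟨h3, h4⟩ | ⟨h3, h4⟩) <;> linarith)

/-- Three far points close to each other are not pairwise separated by lines near `0` parallel to
the axes in such a way that none of the lines separates the same point on both sides. -/
lemma not_three_separated {G₁ G₂ G₃ η₁₂ η₁₃ η₂₃ : ℂ} (hG : 9 ≤ ‖G₁‖)
    (hG₂ : ‖G₂ - G₁‖ ≤ 1 / 10 * ‖G₁‖) (hG₃ : ‖G₃ - G₁‖ ≤ 1 / 10 * ‖G₁‖)
    (h₁₂ : η₁₂ = 1 ∨ η₁₂ = -1 ∨ η₁₂ = Complex.I ∨ η₁₂ = -Complex.I)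
    (h₁₃ : η₁₃ = 1 ∨ η₁₃ = -1 ∨ η₁₃ = Complex.I ∨ η₁₃ = -Complex.I)
    (h₂₃ : η₂₃ = 1 ∨ η₂₃ = -1 ∨ η₂₃ = Complex.I ∨ η₂₃ = -Complex.I)
    (a₁ : (η₁₂ * G₁).re ≤ 3) (a₂ : (-η₁₂ * G₂).re ≤ 3) (b₁ : (η₁₃ * G₁).re ≤ 3)
    (b₃ : (-η₁₃ * G₃).re ≤ 3) (c₂ : (η₂₃ * G₂).re ≤ 3) (c₃ : (-η₂₃ * G₃).re ≤ 3)
    (n₁ : η₁₂ ≠ -η₁₃) (n₂ : η₁₂ ≠ η₂₃) (n₃ : η₁₃ ≠ -η₂₃) : False := by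
  have r₂ := abs_le.1 ((Complex.abs_re_le_norm _).trans hG₂)
  have r₃ := abs_le.1 ((Complex.abs_re_le_norm _).trans hG₃)
  have i₂ := abs_le.1 ((Complex.abs_im_le_norm _).trans hG₂)
  have i₃ := abs_le.1 ((Complex.abs_im_le_norm _).trans hG₃)
  rw [Complex.sub_re] at r₂ r₃
  rw [Complex.sub_im] at i₂ i₃
  obtain ⟨x₁, y₁⟩ := axis_of_large h₁₂ a₁ a₂
  obtain ⟨x₂, y₂⟩ := axis_of_large h₁₃ b₁ b₃
  obtain ⟨x₃, y₃⟩ := axis_of_large h₂₃ c₂ c₃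
  -- Along one axis the first two exclusions force η₁₃ = η₁₂ and η₂₃ = -η₁₂, which the third
  -- forbids.
  have fin : ∀ t : ℂ, (η₁₂ = t ∨ η₁₂ = -t) → (η₁₃ = t ∨ η₁₃ = -t) → (η₂₃ = t ∨ η₂₃ = -t) →
      False := by
    rintro t (rfl | h1) (h2 | h2) (h3 | h3) <;> simp_all
  have hn := sq_norm_eq G₁
  -- Some coordinate is at least (2/3)·9 = 6 in modulus. After a perturbation of a tenth of the norm
  -- it still exceeds 3 for all three points.
  have hbig : ‖G₁‖ ≤ 3 / 2 * |G₁.re| ∨ ‖G₁‖ ≤ 3 / 2 * |G₁.im| := by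
    by_contra! h
    rw [← sq_abs G₁.re, ← sq_abs G₁.im] at hn
    nlinarith [abs_nonneg G₁.re, abs_nonneg G₁.im]
  rcases hbig with hb | hb
  · rcases le_total 0 G₁.re with h0 | h0
    · rw [abs_of_nonneg h0] at hb
      exact fin _ (x₁ (Or.inl ⟨by linarith, by linarith⟩))
        (x₂ (Or.inl ⟨by linarith, by linarith⟩)) (x₃ (Or.inl ⟨by linarith, by linarith⟩))
    · rw [abs_of_nonpos h0] at hb
      exact fin _ (x₁ (Or.inr ⟨by linarith, by linarith⟩))
        (x₂ (Or.inr ⟨by linarith, by linarith⟩)) (x₃ (Or.inr ⟨by linarith, by linarith⟩))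
  · rcases le_total 0 G₁.im with h0 | h0
    · rw [abs_of_nonneg h0] at hb
      exact fin _ (y₁ (Or.inl ⟨by linarith, by linarith⟩))
        (y₂ (Or.inl ⟨by linarith, by linarith⟩)) (y₃ (Or.inl ⟨by linarith, by linarith⟩))
    · rw [abs_of_nonpos h0] at hb
      exact fin _ (y₁ (Or.inr ⟨by linarith, by linarith⟩))
        (y₂ (Or.inr ⟨by linarith, by linarith⟩)) (y₃ (Or.inr ⟨by linarith, by linarith⟩))

lemma two_mul_sqrt_two_le : 2 * Real.sqrt 2 ≤ 3 := by
  have : Real.sqrt 2 ≤ 3 / 2 := by rw [Real.sqrt_le_iff]; norm_num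
  linarith

lemma IsUnitGauss.cases_complex {γ : GaussianInt} (h : IsUnitGauss γ) :
    toComplex γ = 1 ∨ toComplex γ = -1 ∨ toComplex γ = Complex.I ∨
      toComplex γ = -Complex.I := by
  rcases h.cases with rfl | rfl | rfl | rfl <;> simp [toComplex_def']

lemma IsUnitGauss.mul {γ δ : GaussianInt} (h : IsUnitGauss γ) (h' : IsUnitGauss δ) :
    IsUnitGauss (γ * δ) := by
  rw [isUnitGauss_iff_norm] at *
  rw [toComplex_mul, norm_mul, h, h', one_mul]

lemma isUnitGauss_neg_one_pow (n : ℕ) : IsUnitGauss ((-1) ^ n) := by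
  rw [isUnitGauss_iff_norm, map_pow, map_neg, map_one]; simp

/-- The bound 3 covers 2√2: one √2 from the half-plane and one from the offset. -/
lemma re_sign_mul_le {β σ u s : ℂ} (hβ : ‖β‖ = 1) (hσ : ‖σ‖ = 1) (hσ2 : σ * σ = 1)
    (hs : ‖s‖ ≤ Real.sqrt 2) (h : (β * u).re ≤ Real.sqrt 2) :
    (σ * β * (σ * u + s)).re ≤ 3 := by
  have e : σ * β * (σ * u + s) = β * u + σ * β * s := by linear_combination (β * u) * hσ2
  have h1 : (σ * β * s).re ≤ ‖s‖ := by
    refine (Complex.re_le_norm _).trans ?_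
    rw [norm_mul, norm_mul, hβ, hσ]; simp
  rw [e, Complex.add_re]
  linarith [two_mul_sqrt_two_le]

/-- There are no three different good words with the same value and points near them that are
close to each other. -/
lemma not_three_words {L₁ L₂ L₃ : List GaussianInt} (g₁ : Good L₁) (g₂ : Good L₂) (g₃ : Good L₃)
    (n₁₂ : L₁ ≠ L₂) (n₁₃ : L₁ ≠ L₃) (n₂₃ : L₂ ≠ L₃) (l₂ : L₁.length = L₂.length)
    (l₃ : L₁.length = L₃.length) (v₂ : val L₁ = val L₂) (v₃ : val L₁ = val L₃)
    (d₂ : ‖den L₁‖ = ‖den L₂‖) (d₃ : ‖den L₁‖ = ‖den L₃‖)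
    (t₁ : Real.sqrt 2 ≤ ‖toComplex (L₁.getLastD 0)‖)
    (t₂ : Real.sqrt 2 ≤ ‖toComplex (L₂.getLastD 0)‖)
    (t₃ : Real.sqrt 2 ≤ ‖toComplex (L₃.getLastD 0)‖)
    {z₁ z₂ z₃ f₁ f₂ f₃ : ℂ} (o₁ : Chain openSquare z₁ L₁ f₁) (o₂ : Chain openSquare z₂ L₂ f₂)
    (o₃ : Chain openSquare z₃ L₃ f₃) {y₁ y₂ y₃ e₁ e₂ e₃ : ℂ} (c₁ : Chain closedSquare y₁ L₁ e₁)
    (c₂ : Chain closedSquare y₂ L₂ e₂) (c₃ : Chain closedSquare y₃ L₃ e₃)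
    (h₁ : e₁ ≠ 0) (h₂ : e₂ ≠ 0) (h₃ : e₃ ≠ 0) (hbig : 21 / 2 ≤ ‖e₁⁻¹‖)
    (k₂ : ‖y₁ - y₂‖ ≤ 1 / 10 * ‖y₂ - val L₁‖) (k₃ : ‖y₁ - y₃‖ ≤ 1 / 10 * ‖y₃ - val L₁‖) :
    False := by
  obtain ⟨β₁₂, β₂₁, u₁₂, u₂₁, m₁₂, m₂₁, q₁₂, r₁₂, r₂₁⟩ :=
    exists_separation l₂ n₁₂ g₁ g₂ v₂ d₂ (p := 0) o₁ o₂
  obtain ⟨β₁₃, β₃₁, u₁₃, u₃₁, m₁₃, m₃₁, q₁₃, r₁₃, r₃₁⟩ :=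
    exists_separation l₃ n₁₃ g₁ g₃ v₃ d₃ (p := 0) o₁ o₃
  obtain ⟨β₂₃, β₃₂, u₂₃, u₃₂, m₂₃, m₃₂, q₂₃, r₂₃, r₃₂⟩ :=
    exists_separation (l₂ ▸ l₃) n₂₃ g₂ g₃ (v₂ ▸ v₃) (d₂ ▸ d₃) (p := 0) o₂ o₃
  have w₁ := not_near_opposite u₁₂ t₁ m₁₂ m₁₃
  have w₂ := not_near_opposite u₂₁ t₂ m₂₁ m₂₃
  have w₃ := not_near_opposite u₃₁ t₃ m₃₁ m₃₂
  have s₁ := g₁.norm_offset_le_sqrt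
  have s₂ := g₂.norm_offset_le_sqrt
  have s₃ := g₃.norm_offset_le_sqrt
  have x₁ := c₁.coordinate g₁ h₁
  have x₂ := c₂.coordinate g₂ h₂
  have x₃ := c₃.coordinate g₃ h₃
  rw [← l₂, ← v₂] at x₂
  rw [← l₃, ← v₃] at x₃
  have dn₁ := g₁.den_ne_zero
  have dn₂ := g₂.den_ne_zero
  have dn₃ := g₃.den_ne_zero
  have hσ2 := neg_one_pow_mul_self L₁.length
  have hσ : ‖(-1 : ℂ) ^ L₁.length‖ = 1 := by simp
  have hσu := isUnitGauss_neg_one_pow L₁.length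
  have hσc : toComplex ((-1) ^ L₁.length) = (-1) ^ L₁.length := by
    rw [map_pow, map_neg, map_one]
  have A₁₂ := re_sign_mul_le (isUnitGauss_iff_norm.1 u₁₂) hσ hσ2 s₁ (r₁₂ c₁ h₁)
  have A₂₁ := re_sign_mul_le (isUnitGauss_iff_norm.1 u₂₁) hσ hσ2 s₂ (r₂₁ c₂ h₂)
  have A₁₃ := re_sign_mul_le (isUnitGauss_iff_norm.1 u₁₃) hσ hσ2 s₁ (r₁₃ c₁ h₁)
  have A₃₁ := re_sign_mul_le (isUnitGauss_iff_norm.1 u₃₁) hσ hσ2 s₃ (r₃₁ c₃ h₃)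
  have A₂₃ := re_sign_mul_le (isUnitGauss_iff_norm.1 u₂₃) hσ hσ2 s₂ (r₂₃ c₂ h₂)
  have A₃₂ := re_sign_mul_le (isUnitGauss_iff_norm.1 u₃₂) hσ hσ2 s₃ (r₃₂ c₃ h₃)
  have hX₁ : 9 ≤ ‖(-1) ^ L₁.length * e₁⁻¹ + offset L₁‖ := by
    have h := norm_sub_le ((-1) ^ L₁.length * e₁⁻¹ + offset L₁) (offset L₁)
    rw [add_sub_cancel_right, norm_mul, hσ, one_mul] at h
    linarith [two_mul_sqrt_two_le]
  have hκ := u₂₁.conj_mul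
  have uη₁₂ := (hσu.mul u₁₂).cases_complex
  have uη₁₃ := (hσu.mul u₁₃).cases_complex
  have uη₂₃ := (hσu.mul (u₂₃.mul (u₁₂.mul u₂₁.star).neg)).cases_complex
  rw [toComplex_mul, hσc] at uη₁₂ uη₁₃ uη₂₃
  rw [toComplex_mul, toComplex_neg, toComplex_mul, toComplex_star] at uη₂₃
  have w₁' : toComplex β₁₂ ≠ -toComplex β₁₃ := by
    rw [← toComplex_neg]; exact fun h => w₁ (toComplex_injective h)
  have w₂' : toComplex β₂₁ ≠ -toComplex β₂₃ := by
    rw [← toComplex_neg]; exact fun h => w₂ (toComplex_injective h)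
  have w₃' : toComplex β₃₁ ≠ -toComplex β₃₂ := by
    rw [← toComplex_neg]; exact fun h => w₃ (toComplex_injective h)
  generalize (-1 : ℂ) ^ L₁.length = σ at *
  set X₁ := σ * e₁⁻¹ + offset L₁
  set X₂ := σ * e₂⁻¹ + offset L₂
  set X₃ := σ * e₃⁻¹ + offset L₃
  generalize toComplex β₁₂ = b₁₂ at *
  generalize toComplex β₁₃ = b₁₃ at *
  generalize toComplex β₂₁ = b₂₁ at *
  generalize toComplex β₂₃ = b₂₃ at *
  generalize toComplex β₃₁ = b₃₁ at *
  generalize toComplex β₃₂ = b₃₂ at *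
  generalize den L₁ = p₁ at *
  generalize den L₂ = p₂ at *
  generalize den L₃ = p₃ at *
  generalize val L₁ = r at *
  have hσ0 : σ ≠ 0 := by rintro rfl; simp at hσ2
  -- The quotient of the squared denominators is a unit, so the normal for the second and third
  -- words stays parallel to an axis when expressed in the coordinate of the first.
  have κeq : -(b₁₂ * conj b₂₁) = p₁ ^ 2 / p₂ ^ 2 := by
    rw [eq_div_iff (pow_ne_zero 2 dn₂)]
    linear_combination (-conj b₂₁) * q₁₂ + p₁ ^ 2 * hκ
  rw [κeq] at uη₂₃
  have yn₂ : y₂ - r ≠ 0 := by rintro h; rw [h] at x₂; simp at x₂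
  have yn₃ : y₃ - r ≠ 0 := by rintro h; rw [h] at x₃; simp at x₃
  have e₂₁ : b₂₁ = -b₁₂ * p₂ ^ 2 / p₁ ^ 2 := by
    rw [eq_div_iff (pow_ne_zero 2 dn₁)]; linear_combination q₁₂
  have e₃₁ : b₃₁ = -b₁₃ * p₃ ^ 2 / p₁ ^ 2 := by
    rw [eq_div_iff (pow_ne_zero 2 dn₁)]; linear_combination q₁₃
  have e₃₂ : b₃₂ = -b₂₃ * p₃ ^ 2 / p₂ ^ 2 := by
    rw [eq_div_iff (pow_ne_zero 2 dn₂)]; linear_combination q₂₃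
  have close : ∀ {y X p : ℂ}, p ≠ 0 → y - r ≠ 0 → (y - r) * p ^ 2 * X = 1 →
      ‖y₁ - y‖ ≤ 1 / 10 * ‖y - r‖ → ‖X * p ^ 2 / p₁ ^ 2 - X₁‖ ≤ 1 / 10 * ‖X₁‖ := by
    intro y X p hp hy hX hk
    have e : (y - r) * (X * p ^ 2 / p₁ ^ 2 - X₁) = X₁ * (y₁ - y) := by
      field_simp
      linear_combination hX - x₁
    have e' := congrArg norm e
    rw [norm_mul, norm_mul] at e'
    have h0 : 0 < ‖y - r‖ := norm_pos_iff.2 hy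
    refine le_of_mul_le_mul_left ?_ h0
    rw [e']
    nlinarith [_root_.norm_nonneg X₁]
  refine not_three_separated (G₁ := X₁) (G₂ := X₂ * p₂ ^ 2 / p₁ ^ 2) (G₃ := X₃ * p₃ ^ 2 / p₁ ^ 2)
    (η₁₂ := σ * b₁₂) (η₁₃ := σ * b₁₃) (η₂₃ := σ * (b₂₃ * (p₁ ^ 2 / p₂ ^ 2)))
    hX₁ (close dn₂ yn₂ x₂ k₂) (close dn₃ yn₃ x₃ k₃) uη₁₂ uη₁₃ uη₂₃ A₁₂ ?_ A₁₃ ?_ ?_ ?_ ?_ ?_ ?_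
  · rw [e₂₁] at A₂₁
    convert A₂₁ using 2
    ring
  · rw [e₃₁] at A₃₁
    convert A₃₁ using 2
    ring
  · convert A₂₃ using 2
    field_simp
  · rw [e₃₂] at A₃₂
    convert A₃₂ using 2
    field_simp
  · intro h
    exact w₁' (mul_left_cancel₀ hσ0 (by linear_combination h))
  · intro h
    have h' := mul_left_cancel₀ hσ0 h
    apply w₂'
    rw [e₂₁, h']
    field_simp
  · intro h
    have h' : b₁₃ = -(b₂₃ * (p₁ ^ 2 / p₂ ^ 2)) :=
      mul_left_cancel₀ hσ0 (by linear_combination h)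
    apply w₃'
    rw [e₃₁, e₃₂, h']
    field_simp

/-! ### From cylinders to chains. -/

lemma abs_sub_le_of_floor_eq {x : ℝ} {k : ℤ} (h : ⌊x + 1 / 2⌋ = k) : |x - k| ≤ 1 / 2 := by
  rw [Int.floor_eq_iff] at h
  rw [abs_le]
  constructor <;> linarith [h.1, h.2]

lemma sub_mem_closedSquare {x : ℂ} {a : GaussianInt} (h : nearest x = a) :
    x - toComplex a ∈ closedSquare := by
  subst h
  refine ⟨?_, ?_⟩
  · rw [Complex.sub_re, ← intCast_re]; exact abs_sub_le_of_floor_eq rfl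
  · rw [Complex.sub_im, ← intCast_im]; exact abs_sub_le_of_floor_eq rfl

lemma fundDomain_subset : fundDomain ⊆ closedSquare := fun z hz => by
  simpa using sub_mem_closedSquare (show nearest z = 0 from hz)

lemma sub_nearest_mem (x : ℂ) : x - toComplex (nearest x) ∈ fundDomain := by
  have key : ∀ t : ℝ, ⌊t - (⌊t + 1 / 2⌋ : ℤ) + 1 / 2⌋ = 0 := by
    intro t
    rw [show t - (⌊t + 1 / 2⌋ : ℤ) + 1 / 2 = (t + 1 / 2) - (⌊t + 1 / 2⌋ : ℤ) by ring,
      Int.floor_sub_intCast, sub_self]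
  refine Zsqrtd.ext ?_ ?_
  · simp only [nearest, Complex.sub_re, re_toComplex]
    exact key _
  · simp only [nearest, Complex.sub_im, im_toComplex]
    exact key _

lemma gaussMap_of_nearest {z : ℂ} {a : GaussianInt} (hz : z ≠ 0) (h : nearest z⁻¹ = a) :
    gaussMap z = z⁻¹ - toComplex a := by
  rw [gaussMap, if_neg hz, h]

lemma mem_cylinder_succ {n : ℕ} {c : Fin (n + 1) → GaussianInt} {z : ℂ} :
    z ∈ cylinder c ↔ z ∈ fundDomain ∧ z ≠ 0 ∧ nearest z⁻¹ = c 0 ∧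
      gaussMap z ∈ cylinder (fun i : Fin n => c i.succ) := by
  constructor
  · rintro ⟨h1, h2⟩
    have h0 : z ≠ 0 ∧ nearest z⁻¹ = c 0 := h2 0
    refine ⟨h1, h0.1, h0.2, ?_, fun k => h2 k.succ⟩
    rw [gaussMap_of_nearest (a := nearest z⁻¹) h0.1 rfl]
    exact sub_nearest_mem _
  · rintro ⟨h1, h2, h3, h4⟩
    exact ⟨h1, Fin.cases ⟨h2, h3⟩ fun k => h4.2 k⟩

lemma chain_of_mem_cylinder {n : ℕ} : ∀ {c : Fin n → GaussianInt} {z : ℂ}, z ∈ cylinder c →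
    Chain closedSquare z (List.ofFn c) (gaussMap^[n] z) := by
  induction n with
  | zero => intro c z h; rw [List.ofFn_zero]; exact ⟨fundDomain_subset h.1, rfl⟩
  | succ n ih =>
    intro c z h
    obtain ⟨h1, h2, h3, h4⟩ := mem_cylinder_succ.1 h
    have h5 := ih h4
    rw [gaussMap_of_nearest h2 h3] at h5
    rw [List.ofFn_succ, Function.iterate_succ_apply, gaussMap_of_nearest h2 h3]
    exact ⟨fundDomain_subset h1, h2, h5⟩

lemma interior_closedSquare : interior closedSquare = openSquare := by
  have h1 : closedSquare = Set.Icc (-(1 / 2) : ℝ) (1 / 2) ×ℂ Set.Icc (-(1 / 2) : ℝ) (1 / 2) := by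
    ext z; simp [closedSquare, Complex.mem_reProdIm, abs_le]
  rw [h1, Complex.interior_reProdIm, interior_Icc]
  ext z; simp [openSquare, Complex.mem_reProdIm, abs_lt]

lemma gaussMap_mem_interior {n : ℕ} {c : Fin (n + 1) → GaussianInt} {z : ℂ}
    (h : z ∈ interior (cylinder c)) :
    gaussMap z ∈ interior (cylinder (fun i : Fin n => c i.succ)) := by
  obtain ⟨-, h2, h3, -⟩ := mem_cylinder_succ.1 (interior_subset h)
  rw [mem_interior]
  -- This open set is the preimage of the interior under the inverse branch y ↦ 1/(y + c₀) of the
  -- Gauss map.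
  refine ⟨(fun y : ℂ => y + toComplex (c 0)) ⁻¹'
    ({0}ᶜ ∩ (fun y : ℂ => y⁻¹) ⁻¹' interior (cylinder c)), ?_, ?_, ?_⟩
  · rintro y ⟨hy0, hy⟩
    obtain ⟨-, k2, k3, k4⟩ := mem_cylinder_succ.1 (interior_subset hy)
    rw [gaussMap_of_nearest k2 k3, inv_inv, add_sub_cancel_right] at k4
    exact k4
  · refine IsOpen.preimage (by fun_prop) ?_
    exact ContinuousOn.isOpen_inter_preimage (fun y hy => (continuousAt_inv₀ hy).continuousWithinAt)
      isOpen_compl_singleton isOpen_interior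
  · rw [gaussMap_of_nearest h2 h3]
    simp only [Set.mem_preimage, sub_add_cancel, Set.mem_inter_iff, inv_inv]
    exact ⟨inv_ne_zero h2, h⟩

/-- Interior points never meet a tie. The strict inequalities they provide are what `Tangent.step`
needs. -/
lemma chain_of_mem_interior {n : ℕ} : ∀ {c : Fin n → GaussianInt} {z : ℂ},
    z ∈ interior (cylinder c) → Chain openSquare z (List.ofFn c) (gaussMap^[n] z) := by
  have hsub : ∀ {n : ℕ} {c : Fin n → GaussianInt}, interior (cylinder c) ⊆ openSquare := by
    intro n c
    rw [← interior_closedSquare]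
    exact interior_mono fun z hz => fundDomain_subset hz.1
  induction n with
  | zero => intro c z h; rw [List.ofFn_zero]; exact ⟨hsub h, rfl⟩
  | succ n ih =>
    intro c z h
    obtain ⟨-, h2, h3, -⟩ := mem_cylinder_succ.1 (interior_subset h)
    have h5 := ih (gaussMap_mem_interior h)
    rw [gaussMap_of_nearest h2 h3] at h5
    rw [List.ofFn_succ, Function.iterate_succ_apply, gaussMap_of_nearest h2 h3]
    exact ⟨hsub h, h2, h5⟩

lemma mem_cylinder_snoc {n : ℕ} {c : Fin n → GaussianInt} {d : GaussianInt} {z : ℂ}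
    (h : z ∈ cylinder (Fin.snoc c d : Fin (n + 1) → GaussianInt)) :
    z ∈ cylinder c ∧ HasQuotient z n d := by
  refine ⟨⟨h.1, fun k => ?_⟩, ?_⟩
  · simpa using h.2 k.castSucc
  · simpa using h.2 (Fin.last n)

/-! ### Size and position of the unions S_n. -/

lemma maxNorm_le_norm (z : ℂ) : maxNorm z ≤ ‖z‖ :=
  max_le (Complex.abs_re_le_norm z) (Complex.abs_im_le_norm z)

lemma norm_le_maxNorm (z : ℂ) : ‖z‖ ≤ 3 / 2 * maxNorm z := by
  have h1 : |z.re| ≤ maxNorm z := le_max_left _ _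
  have h2 : |z.im| ≤ maxNorm z := le_max_right _ _
  have h3 := sq_norm_eq z
  have h0 := (abs_nonneg _).trans h1
  rw [← sq_abs z.re, ← sq_abs z.im] at h3
  refine le_of_sq_le_sq ?_ (by positivity)
  nlinarith [abs_nonneg z.re, abs_nonneg z.im]

lemma maxNorm_sub_le {x a : ℂ} (h : x - a ∈ closedSquare) :
    maxNorm a - 1 / 2 ≤ maxNorm x ∧ maxNorm x ≤ maxNorm a + 1 / 2 := by
  obtain ⟨h1, h2⟩ := h
  rw [Complex.sub_re] at h1
  rw [Complex.sub_im] at h2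
  have a1 := abs_sub_abs_le_abs_sub x.re a.re
  have a2 := abs_sub_abs_le_abs_sub x.im a.im
  have b1 := abs_sub_abs_le_abs_sub a.re x.re
  have b2 := abs_sub_abs_le_abs_sub a.im x.im
  rw [abs_sub_comm] at b1 b2
  have c1 : |a.re| ≤ maxNorm a := le_max_left _ _
  have c2 : |a.im| ≤ maxNorm a := le_max_right _ _
  have d1 : |x.re| ≤ maxNorm x := le_max_left _ _
  have d2 : |x.im| ≤ maxNorm x := le_max_right _ _
  constructor
  · rw [sub_le_iff_le_add]; exact max_le (by linarith) (by linarith)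
  · exact max_le (by linarith) (by linarith)

/-- The end of the chain of a point of a cylinder of the next level. -/
lemma norm_inv_bounds {n : ℕ} {z : ℂ} {d : GaussianInt} {l u : ℝ} (h : HasQuotient z n d)
    (hl : l ≤ maxNorm (toComplex d)) (hu : maxNorm (toComplex d) ≤ u) :
    l - 1 / 2 ≤ ‖(gaussMap^[n] z)⁻¹‖ ∧ ‖(gaussMap^[n] z)⁻¹‖ ≤ 3 / 2 * (u + 1 / 2) := by
  obtain ⟨h1, h2⟩ := maxNorm_sub_le (sub_mem_closedSquare h.2)
  have h3 := maxNorm_le_norm (gaussMap^[n] z)⁻¹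
  have h4 := norm_le_maxNorm (gaussMap^[n] z)⁻¹
  constructor <;> linarith

/-- What a word with a point in its union of cylinders provides. -/
lemma exists_interior_chain {n : ℕ} {c : Fin n → GaussianInt} {l u : ℝ}
    (h : (regularUnion c l u).Nonempty) :
    ∃ z e, Chain openSquare z (List.ofFn c) e ∧ e ≠ 0 ∧ l - 1 / 2 ≤ ‖e⁻¹‖ := by
  obtain ⟨x, hx⟩ := h
  simp only [regularUnion, Set.mem_iUnion, Set.mem_ofPred_eq] at hx
  obtain ⟨d, ⟨hl, hu, -, z, hz⟩, -⟩ := hx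
  obtain ⟨-, hq⟩ := mem_cylinder_snoc (interior_subset hz)
  have hsub : cylinder (Fin.snoc c d : Fin (n + 1) → GaussianInt) ⊆ cylinder c :=
    fun y hy => (mem_cylinder_snoc hy).1
  exact ⟨z, _, chain_of_mem_interior (interior_mono hsub hz), hq.1, (norm_inv_bounds hq hl hu).1⟩

/-- A point of a closed cylinder need not follow the word, so it is replaced by a nearby point of
the cylinder. -/
lemma exists_chain_of_mem {n : ℕ} {c : Fin n → GaussianInt} {l u : ℝ} {x : ℂ}
    (h : x ∈ regularUnion c l u) {U : Set ℂ} (hU : IsOpen U) (hxU : x ∈ U) :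
    ∃ y ∈ U, ∃ e, Chain closedSquare y (List.ofFn c) e ∧ e ≠ 0 ∧ l - 1 / 2 ≤ ‖e⁻¹‖ ∧
      ‖e⁻¹‖ ≤ 3 / 2 * (u + 1 / 2) := by
  simp only [regularUnion, Set.mem_iUnion, Set.mem_ofPred_eq] at h
  obtain ⟨d, ⟨hl, hu, -⟩, hx⟩ := h
  obtain ⟨y, hyU, hy⟩ := mem_closure_iff.1 hx U hU hxU
  obtain ⟨hyc, hq⟩ := mem_cylinder_snoc hy
  obtain ⟨h1, h2⟩ := norm_inv_bounds hq hl hu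
  exact ⟨y, hyU, _, chain_of_mem_cylinder hyc, hq.1, h1, h2⟩

/-- The distance from the value of the word in terms of the end of the chain. -/
lemma Good.dist_bounds {L : List GaussianInt} (hL : Good L) {y e : ℂ} {l u : ℝ}
    (hc : Chain closedSquare y L e) (he : e ≠ 0) (h1 : l - 1 / 2 ≤ ‖e⁻¹‖)
    (h2 : ‖e⁻¹‖ ≤ 3 / 2 * (u + 1 / 2)) :
    (l - 2) * (‖y - val L‖ * ‖den L‖ ^ 2) ≤ 1 ∧
      1 ≤ (3 / 2 * u + 9 / 4) * (‖y - val L‖ * ‖den L‖ ^ 2) := by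
  have h3 := congrArg norm (hc.coordinate hL he)
  rw [norm_mul, norm_mul, norm_pow, norm_one] at h3
  have hσ : ‖(-1 : ℂ) ^ L.length * e⁻¹‖ = ‖e⁻¹‖ := by simp
  have hs := hL.norm_offset_le_sqrt
  have hs2 := two_mul_sqrt_two_le
  have h4 := norm_add_le ((-1 : ℂ) ^ L.length * e⁻¹) (offset L)
  have h5 := norm_sub_le ((-1 : ℂ) ^ L.length * e⁻¹ + offset L) (offset L)
  rw [add_sub_cancel_right] at h5
  rw [hσ] at h4 h5
  have h6 : 0 ≤ ‖y - val L‖ * ‖den L‖ ^ 2 := by positivity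
  -- With √2 ≤ 3/2, the constants come from l - 1/2 - √2 ≥ l - 2 and 3/4 + √2 ≤ 9/4.
  constructor
  · rw [← h3, mul_comm]
    exact mul_le_mul_of_nonneg_left (by linarith) h6
  · rw [mul_comm]
    refine h3.symm.le.trans (mul_le_mul_of_nonneg_left (by linarith) h6)

lemma IsRegular.good {n : ℕ} {c : Fin n → GaussianInt} (hc : IsRegular c) {l u : ℝ}
    (hl : 11 < l) (h : (regularUnion c l u).Nonempty) : Good (List.ofFn c) := by
  obtain ⟨z, e, h1, h2, h3⟩ := exists_interior_chain h
  refine Chain.good ?_ (h1.mono openSquare_subset) h2 (by linarith)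
  intro a ha
  obtain ⟨i, rfl⟩ := (List.mem_ofFn' _ _).1 ha
  exact hc.1 i

lemma IsRegular.sqrt_two_le_last {n : ℕ} {c : Fin n → GaussianInt} (hc : IsRegular c)
    (hn : 1 ≤ n) : Real.sqrt 2 ≤ ‖toComplex ((List.ofFn c).getLastD 0)‖ := by
  have hne : List.ofFn c ≠ [] := by
    intro h; have := congrArg List.length h; simp at this; omega
  have hmem : (List.ofFn c).getLastD 0 ∈ List.ofFn c := by
    rw [List.getLastD_eq_getLast?, List.getLast?_eq_getLast_of_ne_nil hne, Option.getD_some]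
    exact List.getLast_mem hne
  obtain ⟨i, hi⟩ := (List.mem_ofFn' _ _).1 hmem
  rw [← hi]
  exact hc.1 i

lemma dist_val_le {n : ℕ} {a : Fin n → GaussianInt} {l u : ℝ}
    (hg : Good (List.ofFn a)) {x : ℂ} (hx : x ∈ regularUnion a l u) :
    (l - 2) * (‖x - val (List.ofFn a)‖ * ‖den (List.ofFn a)‖ ^ 2) ≤ 1 := by
  by_contra! h
  have hopen : IsOpen {y : ℂ | 1 < (l - 2) * (‖y - val (List.ofFn a)‖ *
      ‖den (List.ofFn a)‖ ^ 2)} := isOpen_lt (by fun_prop) (by fun_prop)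
  obtain ⟨y, hy, e, hc, he, h1, h2⟩ := exists_chain_of_mem hx hopen h
  exact absurd (hg.dist_bounds hc he h1 h2).1 (not_le.2 hy)

lemma diam_regularUnion_le {n : ℕ} {a : Fin n → GaussianInt} {l u : ℝ} (hl : 2 < l)
    (hg : Good (List.ofFn a)) :
    Metric.diam (regularUnion a l u) * ((l - 2) * ‖den (List.ofFn a)‖ ^ 2) ≤ 2 := by
  have hd := norm_pos_iff.2 hg.den_ne_zero
  have hp : 0 < (l - 2) * ‖den (List.ofFn a)‖ ^ 2 := mul_pos (by linarith) (by positivity)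
  have h1 : regularUnion a l u ⊆ Metric.closedBall (val (List.ofFn a))
      (1 / ((l - 2) * ‖den (List.ofFn a)‖ ^ 2)) := by
    intro x hx
    rw [Metric.mem_closedBall, dist_eq_norm, le_div_iff₀ hp]
    linarith [dist_val_le hg hx]
  have h2 := Metric.diam_mono h1 Metric.isBounded_closedBall
  have h3 := h2.trans (Metric.diam_closedBall (by positivity))
  calc _ ≤ 2 * (1 / ((l - 2) * ‖den (List.ofFn a)‖ ^ 2)) * ((l - 2) * ‖den (List.ofFn a)‖ ^ 2) :=
        mul_le_mul_of_nonneg_right h3 hp.le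
    _ = 2 := by rw [mul_assoc, one_div, inv_mul_cancel₀ hp.ne', mul_one]

/-- Everything needed from a word whose union of cylinders meets the small disc. -/
lemma meets_ball {n : ℕ} {a c : Fin n → GaussianInt} {l u : ℝ} (hl : 11 < l)
    (ha : Good (List.ofFn a)) {z : ℂ} (hz : z ∈ regularUnion a l u)
    (hm : (Metric.ball z (1 / 1000 * Metric.diam (regularUnion a l u)) ∩
      regularUnion c l u).Nonempty) :
    val (List.ofFn c) = val (List.ofFn a) ∧ ‖den (List.ofFn c)‖ = ‖den (List.ofFn a)‖ ∧
      ∃ y ∈ Metric.ball z (1 / 1000 * Metric.diam (regularUnion a l u)), ∃ e,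
        Chain closedSquare y (List.ofFn c) e ∧ e ≠ 0 ∧ l - 1 / 2 ≤ ‖e⁻¹‖ ∧
          ‖e⁻¹‖ ≤ 3 / 2 * (u + 1 / 2) := by
  obtain ⟨x, hxb, hx⟩ := hm
  obtain ⟨y, hy, e, hc, he, h1, h2⟩ := exists_chain_of_mem hx Metric.isOpen_ball hxb
  -- The scaled distance is at most (1 + 2/1000)/(l - 2), and l - 2 > 9 leaves room for the factor
  -- 8.
  have key : 8 * (‖y - val (List.ofFn a)‖ * ‖den (List.ofFn a)‖ ^ 2) ≤ 1 := by
    have h3 := diam_regularUnion_le (l := l) (u := u) (by linarith) ha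
    have h4 := dist_val_le ha hz
    rw [Metric.mem_ball, dist_eq_norm] at hy
    have h5 : ‖y - val (List.ofFn a)‖ ≤ ‖y - z‖ + ‖z - val (List.ofFn a)‖ :=
      norm_sub_le_norm_sub_add_norm_sub _ _ _
    have hq : 0 ≤ ‖den (List.ofFn a)‖ ^ 2 := by positivity
    have h6 : (l - 2) * (‖y - val (List.ofFn a)‖ * ‖den (List.ofFn a)‖ ^ 2) ≤ 1 + 2 / 1000 := by
      have hq' : 0 ≤ (l - 2) * ‖den (List.ofFn a)‖ ^ 2 := mul_nonneg (by linarith) hq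
      have h7 := mul_le_mul_of_nonneg_right (h5.trans (add_le_add_left hy.le _)) hq'
      linarith
    have h8 : 0 ≤ ‖y - val (List.ofFn a)‖ * ‖den (List.ofFn a)‖ ^ 2 := by positivity
    nlinarith
  obtain ⟨k1, k2⟩ := ha.val_eq_of_close (by simp) hc key
  exact ⟨k1, k2, y, hy, e, hc, he, h1, h2⟩

end HurwitzCF

/-! ### Conclusion. -/

open HurwitzCF in
theorem mainTheorem7 :
    ∃ ρ : ℝ, 0 < ρ ∧
      ∀ l u : ℝ, 11 < l → l < u → 22 / 50 < l / u → l / u < 28 / 50 →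
      ∀ n : ℕ, 1 ≤ n →
      ∀ a : Fin n → GaussianInt, HurwitzCF.IsRegular a →
      ∀ z ∈ HurwitzCF.regularUnion a l u,
        {c : Fin n → GaussianInt | HurwitzCF.IsRegular c ∧
          (Metric.ball z (ρ * Metric.diam (HurwitzCF.regularUnion a l u)) ∩
            HurwitzCF.regularUnion c l u).Nonempty}.encard ≤ 2 := by
  refine ⟨1 / 1000, by norm_num, ?_⟩
  intro l u hl hlu hr _ n hn a ha z hz
  have hga := ha.good hl ⟨z, hz⟩
  by_contra! hcard
  obtain ⟨s, hs, hs3⟩ := Set.exists_subset_encard_eq (Order.add_one_le_of_lt hcard)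
  obtain ⟨c₁, c₂, c₃, n₁₂, n₁₃, n₂₃, rfl⟩ := Set.encard_eq_three.1 hs3
  obtain ⟨r₁, m₁⟩ := hs (show c₁ ∈ _ by simp)
  obtain ⟨r₂, m₂⟩ := hs (show c₂ ∈ _ by simp)
  obtain ⟨r₃, m₃⟩ := hs (show c₃ ∈ _ by simp)
  have g₁ := r₁.good hl (m₁.mono Set.inter_subset_right)
  have g₂ := r₂.good hl (m₂.mono Set.inter_subset_right)
  have g₃ := r₃.good hl (m₃.mono Set.inter_subset_right)
  obtain ⟨z₁, f₁, o₁, -, -⟩ := exists_interior_chain (m₁.mono Set.inter_subset_right)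
  obtain ⟨z₂, f₂, o₂, -, -⟩ := exists_interior_chain (m₂.mono Set.inter_subset_right)
  obtain ⟨z₃, f₃, o₃, -, -⟩ := exists_interior_chain (m₃.mono Set.inter_subset_right)
  obtain ⟨v₁, d₁, y₁, b₁, e₁, k₁, h₁, s₁, t₁⟩ := meets_ball hl hga hz m₁
  obtain ⟨v₂, d₂, y₂, b₂, e₂, k₂, h₂, s₂, t₂⟩ := meets_ball hl hga hz m₂
  obtain ⟨v₃, d₃, y₃, b₃, e₃, k₃, h₃, s₃, t₃⟩ := meets_ball hl hga hz m₃
  have hu : 0 < u := by linarith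
  rw [lt_div_iff₀ hu] at hr
  have hD := diam_regularUnion_le (l := l) (u := u) (by linarith) hga
  have hq : 0 < ‖den (List.ofFn a)‖ ^ 2 := by
    have := norm_pos_iff.2 hga.den_ne_zero; positivity
  have close : ∀ {y : ℂ}, y ∈ Metric.ball z (1 / 1000 * Metric.diam (regularUnion a l u)) →
      1 ≤ (3 / 2 * u + 9 / 4) * (‖y - val (List.ofFn a)‖ * ‖den (List.ofFn a)‖ ^ 2) →
      ‖y₁ - y‖ ≤ 1 / 10 * ‖y - val (List.ofFn a)‖ := by
    intro y hy h
    set D := Metric.diam (regularUnion a l u)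
    set q := ‖den (List.ofFn a)‖ ^ 2
    set t := ‖y - val (List.ofFn a)‖
    have h1 : ‖y₁ - y‖ ≤ 1 / 500 * D := by
      rw [Metric.mem_ball] at b₁ hy
      have := dist_triangle_right y₁ y z
      rw [dist_eq_norm] at this
      linarith
    have hD0 : 0 ≤ D := Metric.diam_nonneg
    have ht : 0 ≤ t * q := mul_nonneg (norm_nonneg _) hq.le
    -- The lower bound on l/u makes the inner radius of the second set at least a fifth of 1/((l -
    -- 2)q). Hence D ≤ 10t, and two points of the disc differ by at most D/500 ≤ t/50.
    have h2 : D * q * (l - 2) ≤ 2 := by linarith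
    have h3 : 1 ≤ 5 * (l - 2) * (t * q) :=
      h.trans (mul_le_mul_of_nonneg_right (by linarith) ht)
    have h4 : D * q * (l - 2) ≤ 10 * (t * q) * (l - 2) := by linarith
    have h5 : D * q ≤ 10 * t * q := by
      have := le_of_mul_le_mul_right h4 (by linarith)
      linarith
    have h6 := le_of_mul_le_mul_right h5 hq
    linarith
  have B₂ := (g₂.dist_bounds k₂ h₂ s₂ t₂).2
  have B₃ := (g₃.dist_bounds k₃ h₃ s₃ t₃).2
  rw [v₂, d₂] at B₂
  rw [v₃, d₃] at B₃
  refine not_three_words g₁ g₂ g₃ (fun h => n₁₂ (List.ofFn_injective h))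
    (fun h => n₁₃ (List.ofFn_injective h)) (fun h => n₂₃ (List.ofFn_injective h)) (by simp)
    (by simp) (v₁.trans v₂.symm) (v₁.trans v₃.symm) (d₁.trans d₂.symm) (d₁.trans d₃.symm)
    (r₁.sqrt_two_le_last hn) (r₂.sqrt_two_le_last hn) (r₃.sqrt_two_le_last hn) o₁ o₂ o₃ k₁ k₂ k₃
    h₁ h₂ h₃ (by linarith) ?_ ?_
  · rw [v₁]; exact close b₂ B₂
  · rw [v₁]; exact close b₃ B₃
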